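/- **Conventions.** A *tower of algebras* is a unital associative graded algebra $A=\bigoplus_{n\ge0}A_n$ over $\mathbb C$ in which each $A_n$ is itself a finite-dimensional unital $\mathbb C$-algebra (with its own internal product and unit $1_n$), $A_0\cong\mathbb C$, the unit of $A$ is $1_0$, and the external products $\rho_{m,n}:A_m\otimes A_n\to A_{m+n}$ are injective homomorphisms of unital algebras making $A_{m+n}$ a projective left and a projective right $A_m\otimes A_n$-module. It is *filtered* if each $A_n$ carries a descending chain $A_n=A_n^{(0)}\supseteq A_n^{(1)}\supseteq\cdots$ of left ideals. Let $G_0(A_n)$ be the Grothendieck group of finitely generated left $A_n$-modules (modulo short exact sequences), and let $G(A)=\bigoplus_n G_0(A_n)$, with the usual product $[M][N]=[\mathrm{Ind}_{A_m\otimes A_n}^{A_{m+n}}M\otimes N]$ and the usual coproduct $\Delta[N]=\sum_{k+l=n}[\mathrm{Res}^{A_n}_{A_k\otimes A_l}N]$ for an $A_n$-module $N$, where $G_0(A_k\otimes A_l)$ is identified with $G_0(A_k)\otimes G_0(A_l)$. Let $G(A)_q=G(A)\otimes_{\mathbb Z}\mathbb Z[q]$, with $\Delta$ extended $\mathbb Z[q]$-linearly.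 A $\mathbb Z[q]$-bilinear multiplication $*$ on $G(A)_q$ *quantizes* $G(A)$ if it reduces to the usual product of $G(A)$ at $q=1$. Let $S_1,\dots,S_t$ be the simple $A_1$-modules up to isomorphism, $P_i$ the projective cover of $S_i$, and $\beta=\sum_i\dim(P_i)[S_i]\in G_0(A_1)$. Put $[k]=1+q+\cdots+q^{k-1}$ and $[n]!=[n][n-1]\cdots[1]$. **Theorem.** Let $A$ be a filtered tower of algebras, and suppose that there is a multiplication $*$ on $G(A)_q$ that quantizes $G(A)$ and satisfies: * (Q1) $*$ is associative; * (Q2) $(G(A)_q,*,\Delta)$ is a $q$-twisted Hopf algebra: a graded connected $\mathbb Z[q]$-algebra, with unit the class of the one-dimensional $A_0$-module, whose coproduct $\Delta$ is graded, coassociative and satisfies $\Delta(x*y)=\Delta(x)\cdot_q\Delta(y)$ for all $x,y$, where $(a\otimes b)\cdot_q(a'\otimes b')=q^{\deg(b)\deg(a')}(a*a')\otimes(b*b')$ for homogeneous $b,a'$; * (Q3) $\beta^{*n}=[A_n]_q:=\sum_{i\ge0}q^i\,[A_n^{(i)}/A_n^{(i+1)}]$ for all $n\ge0$ (where $\beta^{*0}$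 is the unit). Then for every $n\ge0$ $$\dim_q(A_n):=\sum_{i\ge0}q^i\dim\bigl(A_n^{(i)}/A_n^{(i+1)}\bigr)=r^n\,[n]!,\qquad r=\dim A_1 .$$ -/

import Mathlib

open scoped TensorProduct Polynomial DirectSum

universe u

noncomputable section

namespace FilteredTowers

/-! ### Finitely generated modules and Grothendieck groups -/

/-- A finitely generated left module over a `ℂ`-algebra `R` (with the induced `ℂ`-structure). -/
structure FGMod (R : Type u) [Ring R] [Algebra ℂ R] : Type (u + 1) where
  carrier : Type u
  [addCommGroup : AddCommGroup carrier]
  [module : Module R carrier]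
  [cmodule : Module ℂ carrier]
  [tower : IsScalarTower ℂ R carrier]
  [finite : Module.Finite R carrier]

namespace FGMod

instance (R : Type u) [Ring R] [Algebra ℂ R] : CoeSort (FGMod R) (Type u) := ⟨FGMod.carrier⟩

attribute [instance] addCommGroup module cmodule tower finite

variable {R S T : Type u} [Ring R] [Algebra ℂ R] [Ring S] [Algebra ℂ S] [Ring T] [Algebra ℂ T]

theorem finiteDimensional [FiniteDimensional ℂ R] (M : FGMod R) : FiniteDimensional ℂ M :=
  Module.Finite.trans R M

/-- Bundling a module. -/
abbrev of (R : Type u) [Ring R] [Algebra ℂ R] (M : Type u) [AddCommGroup M] [Module R M]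
    [Module ℂ M] [IsScalarTower ℂ R M] [Module.Finite R M] : FGMod R := ⟨M⟩

/-- Restriction of a module along a homomorphism of finite-dimensional algebras. -/
def res [FiniteDimensional ℂ T] (f : R →ₐ[ℂ] T) (M : FGMod T) : FGMod R :=
  letI : Module R M := Module.compHom M f.toRingHom
  haveI : IsScalarTower ℂ R M :=
    ⟨fun c r x => by
      change f (c • r) • x = c • (f r • x)
      rw [map_smul, smul_assoc]⟩
  haveI : FiniteDimensional ℂ M := M.finiteDimensional
  haveI : Module.Finite R M := Module.Finite.of_restrictScalars_finite ℂ R M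
  ⟨M⟩

theorem res_smul [FiniteDimensional ℂ T] (f : R →ₐ[ℂ] T) (M : FGMod T) (r : R) (x : M) :
    (r • (show res f M from x) : res f M) = (f r • x : M) := rfl

/-- The action of `R ⊗ S` on `M ⊗ N`. -/
def extAction (M : FGMod R) (N : FGMod S) : R ⊗[ℂ] S →ₐ[ℂ] Module.End ℂ (M ⊗[ℂ] N) :=
  (Module.endTensorEndAlgHom (R := ℂ) (S := ℂ) (A := ℂ) (M := M) (N := N)).comp
    (Algebra.TensorProduct.map (Algebra.lsmul ℂ ℂ M) (Algebra.lsmul ℂ ℂ N))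

theorem extAction_tmul (M : FGMod R) (N : FGMod S) (r : R) (s : S) (x : M) (y : N) :
    extAction M N (r ⊗ₜ s) (x ⊗ₜ y) = (r • x) ⊗ₜ (s • y) := rfl

/-- The external tensor product `M ⊗_ℂ N`, a module over `R ⊗_ℂ S`. -/
def ext [FiniteDimensional ℂ R] [FiniteDimensional ℂ S] (M : FGMod R) (N : FGMod S) :
    FGMod (R ⊗[ℂ] S) :=
  letI : Module (R ⊗[ℂ] S) (M ⊗[ℂ] N) := Module.compHom _ (extAction M N).toRingHom
  haveI : IsScalarTower ℂ (R ⊗[ℂ] S) (M ⊗[ℂ] N) :=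
    ⟨fun c r x => by
      change extAction M N (c • r) x = c • (extAction M N r x)
      rw [map_smul, LinearMap.smul_apply]⟩
  haveI : FiniteDimensional ℂ M := M.finiteDimensional
  haveI : FiniteDimensional ℂ N := N.finiteDimensional
  haveI : Module.Finite (R ⊗[ℂ] S) (M ⊗[ℂ] N) := Module.Finite.of_restrictScalars_finite ℂ _ _
  ⟨M ⊗[ℂ] N⟩

theorem ext_smul [FiniteDimensional ℂ R] [FiniteDimensional ℂ S] (M : FGMod R) (N : FGMod S)
    (r : R ⊗[ℂ] S) (x : M ⊗[ℂ] N) :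
    (r • (show ext M N from x) : ext M N) = extAction M N r x := rfl

/-- The relations `a f(b) ⊗ y = a ⊗ b y` defining an induced module. -/
def indRel (f : R →ₐ[ℂ] T) (N : FGMod R) : Submodule T (T ⊗[ℂ] N) :=
  Submodule.span T {z | ∃ (a : T) (b : R) (y : N), z = (a * f b) ⊗ₜ[ℂ] y - a ⊗ₜ[ℂ] (b • y)}

/-- The induced module `T ⊗_R N`. -/
def ind [FiniteDimensional ℂ R] (f : R →ₐ[ℂ] T) (N : FGMod R) : FGMod T :=
  haveI : FiniteDimensional ℂ N := N.finiteDimensional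
  of T ((T ⊗[ℂ] N) ⧸ indRel f N)

end FGMod

open FGMod

section G0

variable (R : Type u) [Ring R] [Algebra ℂ R]

/-- The subgroup spanned by `(M) - (L) - (N)` for short exact sequences `0 → L → M → N → 0`. -/
def exactRelations : AddSubgroup (FreeAbelianGroup (FGMod R)) :=
  AddSubgroup.closure {z | ∃ (L M N : FGMod R) (f : L →ₗ[R] M) (g : M →ₗ[R] N),
    Function.Injective f ∧ Function.Exact f g ∧ Function.Surjective g ∧
    z = FreeAbelianGroup.of M - FreeAbelianGroup.of L - FreeAbelianGroup.of N}

/-- The Grothendieck group of finitely generated `R`-modules. (Isomorphic modules get the same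
class, by the exact sequences `0 → L → M → 0 → 0`.) -/
def G0 : Type (u + 1) := FreeAbelianGroup (FGMod R) ⧸ exactRelations R

instance : AddCommGroup (G0 R) := QuotientAddGroup.Quotient.addCommGroup _

end G0

namespace G0

variable {R S T : Type u} [Ring R] [Algebra ℂ R] [Ring S] [Algebra ℂ S] [Ring T] [Algebra ℂ T]

/-- The class of a module. -/
def mk (M : FGMod R) : G0 R := QuotientAddGroup.mk' (exactRelations R) (FreeAbelianGroup.of M)

theorem mk_exact {L M N : FGMod R} (f : L →ₗ[R] M) (g : M →ₗ[R] N) (hf : Function.Injective f)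
    (hfg : Function.Exact f g) (hg : Function.Surjective g) : mk M = mk L + mk N := by
  have : QuotientAddGroup.mk' (exactRelations R) (FreeAbelianGroup.of M - FreeAbelianGroup.of L
      - FreeAbelianGroup.of N) = 0 :=
    (QuotientAddGroup.eq_zero_iff _).2
      (AddSubgroup.subset_closure ⟨L, M, N, f, g, hf, hfg, hg, rfl⟩)
  rw [map_sub, map_sub, sub_sub, sub_eq_zero] at this
  exact this

/-- Additive functions on modules are functions on the Grothendieck group. -/
def lift {B : Type*} [AddCommGroup B] (φ : FGMod R → B)
    (h : ∀ (L M N : FGMod R) (f : L →ₗ[R] M) (g : M →ₗ[R] N), Function.Injective f →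
      Function.Exact f g → Function.Surjective g → φ M = φ L + φ N) : G0 R →+ B :=
  QuotientAddGroup.lift (exactRelations R) (FreeAbelianGroup.lift φ) (by
    rw [exactRelations, AddSubgroup.closure_le]
    rintro z ⟨L, M, N, f, g, hf, hfg, hg, rfl⟩
    simp [h L M N f g hf hfg hg])

@[simp] theorem lift_mk {B : Type*} [AddCommGroup B] (φ : FGMod R → B) (h) (M : FGMod R) :
    lift φ h (mk M) = φ M :=
  FreeAbelianGroup.lift_apply_of φ M

theorem induction {p : G0 R → Prop} (h0 : ∀ M, p (mk M)) (hadd : ∀ x y, p x → p y → p (x + y))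
    (hneg : ∀ x, p x → p (-x)) (hz : p 0) (x : G0 R) : p x := by
  induction x using QuotientAddGroup.induction_on with
  | H x =>
    induction x using FreeAbelianGroup.induction_on with
    | zero => exact hz
    | of M => exact h0 M
    | neg M h => exact hneg _ h
    | add x y hx hy => exact hadd _ _ hx hy

theorem hom_ext {B : Type*} [AddCommGroup B] {f g : G0 R →+ B}
    (h : ∀ M, f (mk M) = g (mk M)) : f = g := by
  ext x
  induction x using G0.induction with
  | h0 M => exact h M
  | hadd x y hx hy => rw [map_add, map_add, hx, hy]
  | hneg x hx => rw [map_neg, map_neg, hx]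
  | hz => simp

theorem mk_subsingleton (M : FGMod R) [Subsingleton M] : mk M = 0 := by
  have := mk_exact (L := M) (M := M) (N := M) LinearMap.id LinearMap.id Function.injective_id
    (fun y => ⟨fun _ => ⟨y, rfl⟩, fun _ => Subsingleton.elim _ _⟩) Function.surjective_id
  simpa using this

theorem mk_congr {M N : FGMod R} (e : M ≃ₗ[R] N) : mk M = mk N := by
  have : mk N = mk M + mk (FGMod.of R PUnit.{u + 1}) :=
    mk_exact (N := FGMod.of R PUnit.{u + 1}) e.toLinearMap 0 e.injective
      (fun y => ⟨fun _ => ⟨e.symm y, by simp⟩, fun _ => rfl⟩) (fun y => ⟨0, rfl⟩)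
  rw [this, mk_subsingleton (FGMod.of R PUnit.{u + 1}), add_zero]

/-- Restriction on Grothendieck groups. -/
def res [FiniteDimensional ℂ T] (f : R →ₐ[ℂ] T) : G0 T →+ G0 R :=
  lift (fun M => mk (M.res f)) fun L M N a b ha hab hb =>
    mk_exact (L := L.res f) (M := M.res f) (N := N.res f)
      { toFun := a, map_add' := a.map_add, map_smul' := fun r x => a.map_smul (f r) x }
      { toFun := b, map_add' := b.map_add, map_smul' := fun r x => b.map_smul (f r) x } ha hab hb

theorem ext_map_smul {M M' : FGMod R} {N N' : FGMod S} (a : M →ₗ[R] M') (b : N →ₗ[S] N')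
    (r : R ⊗[ℂ] S) (x : M ⊗[ℂ] N) :
    TensorProduct.map (a.restrictScalars ℂ) (b.restrictScalars ℂ) (extAction M N r x) =
      extAction M' N' r (TensorProduct.map (a.restrictScalars ℂ) (b.restrictScalars ℂ) x) := by
  induction r using TensorProduct.induction_on with
  | zero => simp
  | add r s hr hs => simp only [map_add, LinearMap.add_apply, hr, hs]
  | tmul r s =>
    induction x using TensorProduct.induction_on with
    | zero => simp
    | add x y hx hy => simp only [map_add, hx, hy]
    | tmul x y => simp [extAction_tmul]

variable [FiniteDimensional ℂ R] [FiniteDimensional ℂ S]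

/-- Functoriality of the external tensor product. -/
def extMap {M M' : FGMod R} {N N' : FGMod S} (a : M →ₗ[R] M') (b : N →ₗ[S] N') :
    ext M N →ₗ[R ⊗[ℂ] S] ext M' N' where
  toFun := TensorProduct.map (a.restrictScalars ℂ) (b.restrictScalars ℂ)
  map_add' := map_add _
  map_smul' r x := ext_map_smul a b r x

/-- The canonical map `G₀(R) ⊗ G₀(S) → G₀(R ⊗ S)`, `[M] ⊗ [N] ↦ [M ⊗ N]`. -/
def ext : G0 R ⊗[ℤ] G0 S →+ G0 (R ⊗[ℂ] S) :=
  TensorProduct.liftAddHom (lift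
    (fun M => lift (fun N => mk (M.ext N)) fun L N P a b ha hab hb =>
      mk_exact (extMap LinearMap.id a) (extMap LinearMap.id b)
        (Module.Flat.lTensor_preserves_injective_linearMap (M := M) (a.restrictScalars ℂ) ha)
        (lTensor_exact M (f := a.restrictScalars ℂ) (g := b.restrictScalars ℂ) hab hb)
        (LinearMap.lTensor_surjective M (g := b.restrictScalars ℂ) hb))
    fun L M N a b ha hab hb => hom_ext fun P => by
      simp only [lift_mk, AddMonoidHom.add_apply]
      exact mk_exact (extMap a LinearMap.id) (extMap b LinearMap.id)
        (Module.Flat.rTensor_preserves_injective_linearMap (M := P) (a.restrictScalars ℂ) ha)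
        (rTensor_exact P (f := a.restrictScalars ℂ) (g := b.restrictScalars ℂ) hab hb)
        (LinearMap.rTensor_surjective P (g := b.restrictScalars ℂ) hb))
    fun r x y => by rw [map_zsmul, map_zsmul, AddMonoidHom.zsmul_apply]

@[simp] theorem ext_mk (M : FGMod R) (N : FGMod S) : ext (mk M ⊗ₜ mk N) = mk (M.ext N) := by
  rw [ext, TensorProduct.liftAddHom_tmul, lift_mk, lift_mk]

end G0

/-! ### The identification `G₀(R) ⊗ G₀(S) = G₀(R ⊗ S)` -/

section Kunneth

open scoped Matrix

variable {R S : Type u} [Ring R] [Algebra ℂ R] [Ring S] [Algebra ℂ S]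

/-- Submodules of modules over a finite-dimensional algebra. -/
def FGMod.sub [FiniteDimensional ℂ R] (M : FGMod R) (p : Submodule R M) : FGMod R :=
  haveI : FiniteDimensional ℂ M := M.finiteDimensional
  haveI : FiniteDimensional ℂ p := inferInstanceAs (FiniteDimensional ℂ (p.restrictScalars ℂ))
  haveI : Module.Finite R p := Module.Finite.of_restrictScalars_finite ℂ R p
  FGMod.of R p

/-- Quotient modules. -/
def FGMod.quot (M : FGMod R) (p : Submodule R M) : FGMod R := FGMod.of R (M ⧸ p)

theorem G0.mk_sub_add_quot [FiniteDimensional ℂ R] (M : FGMod R) (p : Submodule R M) :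
    G0.mk M = G0.mk (M.sub p) + G0.mk (M.quot p) :=
  G0.mk_exact (L := M.sub p) (N := M.quot p) p.subtype p.mkQ p.injective_subtype
    (LinearMap.exact_subtype_mkQ p) p.mkQ_surjective

/-- Induction: to show that a class of modules lies in a subgroup, find nonzero submodules. -/
theorem G0.mk_mem_of_forall [FiniteDimensional ℂ R] (H : AddSubgroup (G0 R))
    (h : ∀ X : FGMod R, Nontrivial X → ∃ (Y : FGMod R) (f : Y →ₗ[R] X),
      Nontrivial Y ∧ Function.Injective f ∧ G0.mk Y ∈ H) (X : FGMod R) : G0.mk X ∈ H := by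
  obtain ⟨n, hn⟩ : ∃ n, Module.finrank ℂ X = n := ⟨_, rfl⟩
  induction n using Nat.strong_induction_on generalizing X with
  | _ n ih =>
    rcases subsingleton_or_nontrivial X with hX | hX
    · rw [G0.mk_subsingleton]; exact H.zero_mem
    obtain ⟨Y, f, hY, hf, hYH⟩ := h X hX
    have : FiniteDimensional ℂ X := X.finiteDimensional
    have h1 : G0.mk X = G0.mk Y + G0.mk (X.quot (LinearMap.range f)) :=
      G0.mk_exact (N := X.quot (LinearMap.range f)) f (LinearMap.range f).mkQ hf
        (LinearMap.exact_map_mkQ_range f) (Submodule.mkQ_surjective _)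
    rw [h1]
    refine H.add_mem hYH (ih _ ?_ _ rfl)
    have h2 := Submodule.finrank_quotient_add_finrank ((LinearMap.range f).restrictScalars ℂ)
    have h3 : 0 < Module.finrank ℂ ((LinearMap.range f).restrictScalars ℂ) := by
      rw [Module.finrank_pos_iff]
      obtain ⟨y, hy⟩ := exists_ne (0 : Y)
      exact ⟨⟨f y, ⟨y, rfl⟩⟩, 0, fun h => hy (hf (by simpa using congrArg Subtype.val h))⟩
    change Module.finrank ℂ (X ⧸ (LinearMap.range f).restrictScalars ℂ) < n
    omega

/-- A surjection of `R` onto a product of matrix algebras with kernel the Jacobson radical,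
with lifts of the matrix units and of idempotents. -/
structure Split (R : Type u) [Ring R] [Algebra ℂ R] where
  n : ℕ
  d : Fin n → ℕ
  [ne : ∀ i, NeZero (d i)]
  φ : R →ₐ[ℂ] ∀ i, Matrix (Fin (d i)) (Fin (d i)) ℂ
  ker_eq : RingHom.ker φ = Ring.jacobson R
  u : ∀ i, Fin (d i) → Fin (d i) → R
  φu : ∀ i j k, φ (u i j k) = Pi.single i (Matrix.single j k 1)
  e : Fin n → R
  idem : ∀ i, e i * e i = e i
  φe : ∀ i, φ (e i) = Pi.single i (Matrix.single 0 0 1)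

attribute [instance] Split.ne

theorem exists_split [FiniteDimensional ℂ R] : Nonempty (Split R) := by
  have : IsArtinianRing R := IsArtinianRing.of_finite ℂ R
  obtain ⟨n, d, hd, ⟨e⟩⟩ :=
    IsSemisimpleRing.exists_algEquiv_pi_matrix_of_isAlgClosed ℂ (R ⧸ Ring.jacobson R)
  let φ : R →ₐ[ℂ] ∀ i, Matrix (Fin (d i)) (Fin (d i)) ℂ :=
    e.toAlgHom.comp (Ideal.Quotient.mkₐ ℂ (Ring.jacobson R))
  have hs : Function.Surjective φ := e.surjective.comp Ideal.Quotient.mk_surjective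
  have hk : RingHom.ker φ = Ring.jacobson R := by
    ext x
    rw [RingHom.mem_ker]
    change e (Ideal.Quotient.mk _ x) = 0 ↔ _
    rw [map_eq_zero_iff _ e.injective, Ideal.Quotient.eq_zero_iff_mem]
  choose u hu using fun i j k => hs (Pi.single i (Matrix.single j k 1))
  have hnil : ∀ x ∈ RingHom.ker φ.toRingHom, IsNilpotent x := by
    intro x hx
    obtain ⟨N, hN⟩ := IsSemiprimaryRing.isNilpotent (R := R)
    have hx' : x ∈ Ring.jacobson R := hk ▸ hx
    refine ⟨N, ?_⟩
    have := Ideal.pow_mem_pow hx' N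
    rw [hN] at this
    simpa using this
  have := fun i => exists_isIdempotentElem_eq_of_ker_isNilpotent φ.toRingHom hnil
    (Pi.single i (Matrix.single 0 0 1)) (hs _) (by
      rw [IsIdempotentElem, ← Pi.single_mul]; simp)
  choose f hf hf' using this
  exact ⟨⟨n, d, φ, hk, u, hu, f, hf, hf'⟩⟩

namespace Split

variable (P : Split R)

theorem φ_mul_u (r : R) (i) (l k : Fin (P.d i)) :
    P.φ (r * P.u i l k) = P.φ (∑ m, P.φ r i m l • P.u i m k) := by
  rw [map_mul, map_sum, P.φu]
  simp only [map_smul, P.φu]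
  ext i' a b
  by_cases h : i' = i
  · subst h
    simp only [Pi.mul_apply, Pi.single_eq_same, Finset.sum_apply, Pi.smul_apply,
      Matrix.sum_apply, Matrix.smul_apply, Matrix.single_apply, Matrix.mul_apply, smul_eq_mul]
    by_cases hb : k = b <;> simp [hb, Finset.sum_ite_eq']
  · simp [Pi.single_eq_of_ne h]

theorem φ_u_mul_u (i) (j k l m : Fin (P.d i)) :
    P.φ (P.u i j k * P.u i l m) = P.φ (if k = l then P.u i j m else 0) := by
  rw [map_mul, P.φu, P.φu, ← Pi.single_mul]
  split_ifs with h
  · subst h; simp [P.φu]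
  · simp [Matrix.single_mul_single_of_ne _ _ _ _ h]

theorem φ_one : P.φ 1 = P.φ (∑ i, ∑ l, P.u i l l) := by
  simp only [map_one, map_sum, P.φu]
  ext i a b
  simp only [Finset.sum_apply, Pi.one_apply]
  rw [Finset.sum_eq_single i]
  · simp [Matrix.sum_apply, Matrix.one_apply, Matrix.single_apply, ite_and]
  · intro j _ hj
    simp [Pi.single_eq_of_ne hj.symm]
  · simp

theorem φ_e_mul (i) (k : Fin (P.d i)) : P.φ (P.e i * P.u i 0 k) = P.φ (P.u i 0 k) := by
  rw [map_mul, P.φu, P.φe, ← Pi.single_mul]; simp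

theorem φ_e (i) : P.φ (P.e i) = P.φ (P.u i 0 0) := by rw [P.φe, P.φu]

section vec
variable {M : Type u} [AddCommGroup M] [Module R M]

/-- The vectors generating copies of the `i`-th simple module. -/
def Good (i : Fin P.n) (x : M) : Prop := P.e i • x = x ∧ ∀ j, P.φ j = 0 → j • x = 0

theorem smul_eq {x : M} (hx : ∀ j, P.φ j = 0 → j • x = 0) {r s : R} (h : P.φ r = P.φ s) :
    r • x = s • x := by
  rw [← sub_eq_zero, ← sub_smul]; exact hx _ (by rw [map_sub, h, sub_self])

theorem exists_good [FiniteDimensional ℂ R] [Module.Finite R M] [Nontrivial M] :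
    ∃ i, ∃ x : M, x ≠ 0 ∧ P.Good i x := by
  have : IsArtinianRing R := IsArtinianRing.of_finite ℂ R
  obtain h | ⟨p, hp, -⟩ := eq_bot_or_exists_atom_le (⊤ : Submodule R M)
  · exact absurd h top_ne_bot
  have : IsSimpleModule R p := isSimpleModule_iff_isAtom.2 hp
  have : Nontrivial p := IsSimpleModule.nontrivial R p
  obtain ⟨x, hx⟩ := exists_ne (0 : p)
  have hJ : ∀ j, P.φ j = 0 → j • x = 0 := fun j hj => by
    have h1 : j ∈ Ring.jacobson R := P.ker_eq ▸ hj
    exact Module.mem_annihilator.1 (IsSemisimpleModule.jacobson_le_annihilator R p h1) x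
  have h1 : ∑ i, ∑ l, P.u i l l • x ≠ 0 := by
    have := P.smul_eq hJ P.φ_one
    rw [one_smul] at this
    simp only [Finset.sum_smul] at this
    rwa [← this]
  obtain ⟨i, -, hi⟩ := Finset.exists_ne_zero_of_sum_ne_zero h1
  obtain ⟨l, -, hl⟩ := Finset.exists_ne_zero_of_sum_ne_zero hi
  have h2 : P.u i 0 l • x ≠ 0 := fun h => hl (by
    rw [← P.smul_eq hJ (r := P.u i l 0 * P.u i 0 l) (by rw [P.φ_u_mul_u, if_pos rfl]),
      mul_smul, h, smul_zero])
  refine ⟨i, ((P.u i 0 l • x : p) : M), fun h => h2 (Subtype.ext h), ?_, fun j hj => ?_⟩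
  · rw [← Submodule.coe_smul, smul_smul, P.smul_eq hJ (P.φ_e_mul i l)]
  · rw [← Submodule.coe_smul, smul_smul, hJ _ (by rw [map_mul, hj, zero_mul])]; rfl

theorem Good.smul_u {i} {x : M} (hx : P.Good i x) (r : R) (l) :
    r • P.u i l 0 • x = ∑ m, (P.φ r i m l • P.u i m 0) • x := by
  rw [smul_smul, P.smul_eq hx.2 (P.φ_mul_u r i l 0), Finset.sum_smul]

theorem Good.u_smul_u {i} {x : M} (hx : P.Good i x) (l m) :
    P.u i 0 l • P.u i m 0 • x = if l = m then x else 0 := by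
  rw [smul_smul, P.smul_eq hx.2 (P.φ_u_mul_u i 0 l m 0)]
  split_ifs
  · rw [← P.smul_eq hx.2 (P.φ_e i), hx.1]
  · exact zero_smul _ _

end vec

/-- The `i`-th simple module. -/
def std (i : Fin P.n) : FGMod R :=
  letI : Module R (Fin (P.d i) → ℂ) := Module.compHom _
    ((Matrix.toLinAlgEquiv' (R := ℂ) (n := Fin (P.d i))).toAlgHom.comp
      ((Pi.evalAlgHom ℂ _ i).comp P.φ)).toRingHom
  haveI : IsScalarTower ℂ R (Fin (P.d i) → ℂ) := ⟨fun c r x => by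
    change P.φ (c • r) i *ᵥ x = c • (P.φ r i *ᵥ x)
    rw [map_smul, Pi.smul_apply, Matrix.smul_mulVec]⟩
  haveI : IsScalarTower ℂ R (ULift.{u} (Fin (P.d i) → ℂ)) :=
    ⟨fun c r x => ULift.ext _ _ (smul_assoc c r x.down)⟩
  haveI : Module.Finite R (ULift.{u} (Fin (P.d i) → ℂ)) :=
    Module.Finite.of_restrictScalars_finite ℂ R _
  FGMod.of R (ULift.{u} (Fin (P.d i) → ℂ))

/-- The coordinates of a vector of the `i`-th simple module. -/
def coord (i : Fin P.n) : P.std i ≃ₗ[ℂ] (Fin (P.d i) → ℂ) := ULift.moduleEquiv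

theorem coord_smul (i : Fin P.n) (r : R) (v : P.std i) :
    P.coord i (r • v) = P.φ r i *ᵥ P.coord i v := rfl

theorem std_nontrivial (i : Fin P.n) : Nontrivial (P.std i) :=
  (P.coord i).toEquiv.nontrivial

/-- A good vector spans a copy of the simple module. -/
theorem exists_std_hom {M : FGMod R} {i} {x : M} (hx0 : x ≠ 0) (hx : P.Good i x) :
    ∃ f : P.std i →ₗ[R] M, Function.Injective f := by
  let f : P.std i →ₗ[R] M :=
    { toFun := fun v => ∑ l, P.coord i v l • P.u i l 0 • x
      map_add' := fun v w => by
        simp only [map_add, Pi.add_apply, add_smul, Finset.sum_add_distrib]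
      map_smul' := fun r v => by
        simp only [P.coord_smul, RingHom.id_apply, Finset.smul_sum, Matrix.mulVec, dotProduct,
          Finset.sum_smul]
        rw [Finset.sum_comm]
        refine Finset.sum_congr rfl fun l _ => ?_
        rw [smul_comm, hx.smul_u, Finset.smul_sum]
        refine Finset.sum_congr rfl fun m _ => ?_
        rw [smul_assoc, smul_smul, mul_comm] }
  refine ⟨f, (injective_iff_map_eq_zero f).2 fun v hv => (P.coord i).injective ?_⟩
  rw [map_zero]
  ext l
  have h := congrArg (fun y => P.u i 0 l • y) hv
  simp only [smul_zero] at h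
  change P.u i 0 l • ∑ m, P.coord i v m • P.u i m 0 • x = 0 at h
  simp only [Finset.smul_sum, smul_comm (P.u i 0 l) (P.coord i v _), hx.u_smul_u, smul_ite,
    smul_zero, Finset.sum_ite_eq, Finset.mem_univ, if_true] at h
  exact (smul_eq_zero.1 h).resolve_right hx0

theorem smul_smul_comm (X : FGMod (R ⊗[ℂ] S)) (r : R) (s : S) (x : X) :
    (r ⊗ₜ[ℂ] (1 : S)) • ((1 : R) ⊗ₜ[ℂ] s) • x = ((1 : R) ⊗ₜ[ℂ] s) • (r ⊗ₜ[ℂ] (1 : S)) • x := by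
  simp [smul_smul]

theorem e_smul_mem (i : Fin P.n) (X : FGMod (R ⊗[ℂ] S)) (x : X) :
    (P.e i ⊗ₜ[ℂ] (1 : S)) • (P.e i ⊗ₜ[ℂ] (1 : S)) • x = (P.e i ⊗ₜ[ℂ] (1 : S)) • x := by
  rw [smul_smul, Algebra.TensorProduct.tmul_mul_tmul, P.idem, one_mul]

theorem coord_e (i : Fin P.n) (v : P.std i) :
    P.coord i (P.e i • v) = Pi.single 0 (P.coord i v 0) := by
  rw [P.coord_smul, P.φe, Pi.single_eq_same]
  ext l
  simp [Matrix.single_mulVec, Pi.single_apply, Function.update_apply]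

theorem e_smul_of_ne {i j : Fin P.n} (h : j ≠ i) (v : P.std j) : P.e i • v = 0 := by
  refine (P.coord j).injective ?_
  rw [P.coord_smul, P.φe, Pi.single_eq_of_ne h, Matrix.zero_mulVec, map_zero]

variable [FiniteDimensional ℂ R]

theorem exists_sum (x : G0 R) : ∃ c : Fin P.n → ℤ, x = ∑ i, c i • G0.mk (P.std i) := by
  let H : AddSubgroup (G0 R) := AddSubgroup.closure (Set.range fun i => G0.mk (P.std i))
  have hx : x ∈ H := by
    induction x using G0.induction with
    | h0 M =>
      refine G0.mk_mem_of_forall H (fun X hX => ?_) M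
      obtain ⟨i, x, hx0, hx⟩ := P.exists_good (M := X)
      obtain ⟨f, hf⟩ := P.exists_std_hom hx0 hx
      exact ⟨P.std i, f, P.std_nontrivial i, hf, AddSubgroup.subset_closure ⟨i, rfl⟩⟩
    | hadd x y hx hy => exact H.add_mem hx hy
    | hneg x hx => exact H.neg_mem hx
    | hz => exact H.zero_mem
  induction hx using AddSubgroup.closure_induction with
  | mem x hx =>
    obtain ⟨i, rfl⟩ := hx
    exact ⟨Pi.single i 1, by simp [Pi.single_apply]⟩
  | zero => exact ⟨0, by simp⟩
  | add x y _ _ hx hy =>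
    obtain ⟨c, rfl⟩ := hx
    obtain ⟨d, rfl⟩ := hy
    exact ⟨c + d, by simp [add_smul, Finset.sum_add_distrib]⟩
  | neg x _ hx =>
    obtain ⟨c, rfl⟩ := hx
    exact ⟨-c, by simp⟩

variable [FiniteDimensional ℂ S]

/-- The `S`-module of good vectors. -/
def goodSub (i : Fin P.n) (X : FGMod (R ⊗[ℂ] S)) :
    Submodule S (X.res (Algebra.TensorProduct.includeRight : S →ₐ[ℂ] R ⊗[ℂ] S)) where
  carrier := {x | P.Good (M := X.res (Algebra.TensorProduct.includeLeft : R →ₐ[ℂ] R ⊗[ℂ] S)) i x}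
  add_mem' hx hy := ⟨(smul_add _ _ _).trans (congrArg₂ _ hx.1 hy.1), fun j hj =>
    (smul_add _ _ _).trans ((congrArg₂ _ (hx.2 j hj) (hy.2 j hj)).trans (add_zero _))⟩
  zero_mem' := ⟨smul_zero (A := X) (P.e i ⊗ₜ[ℂ] (1 : S)),
    fun j _ => smul_zero (A := X) (j ⊗ₜ[ℂ] (1 : S))⟩
  smul_mem' s x hx := ⟨(smul_smul_comm X (P.e i) s x).trans (congrArg _ hx.1), fun j hj =>
    (smul_smul_comm X j s x).trans ((congrArg _ (hx.2 j hj)).trans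
      (smul_zero (A := X) ((1 : R) ⊗ₜ[ℂ] s)))⟩

/-- The `S`-module of good vectors. -/
def goodMod (i : Fin P.n) (X : FGMod (R ⊗[ℂ] S)) : FGMod S :=
  (X.res (Algebra.TensorProduct.includeRight : S →ₐ[ℂ] R ⊗[ℂ] S)).sub (P.goodSub i X)

/-- The embedding of the good vectors. -/
def goodVal (i : Fin P.n) (X : FGMod (R ⊗[ℂ] S)) : P.goodMod i X →ₗ[ℂ] X :=
  (P.goodSub i X).subtype.restrictScalars ℂ

theorem goodVal_injective (i : Fin P.n) (X : FGMod (R ⊗[ℂ] S)) :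
    Function.Injective (P.goodVal i X) := Subtype.val_injective

theorem goodVal_smul (i : Fin P.n) (X : FGMod (R ⊗[ℂ] S)) (s : S) (y : P.goodMod i X) :
    P.goodVal i X (s • y) = ((1 : R) ⊗ₜ[ℂ] s) • P.goodVal i X y := rfl

theorem goodVal_good (i : Fin P.n) (X : FGMod (R ⊗[ℂ] S)) (y : P.goodMod i X) :
    P.Good (M := X.res (Algebra.TensorProduct.includeLeft : R →ₐ[ℂ] R ⊗[ℂ] S)) i
      (P.goodVal i X y) := y.2

/-- The underlying linear map of `goodHom`. -/
def goodLin (i : Fin P.n) (X : FGMod (R ⊗[ℂ] S)) : P.std i ⊗[ℂ] P.goodMod i X →ₗ[ℂ] X :=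
  TensorProduct.lift (∑ l, LinearMap.smulRight (LinearMap.proj l ∘ₗ (P.coord i).toLinearMap)
    (Algebra.lsmul ℂ ℂ X (P.u i l 0 ⊗ₜ[ℂ] (1 : S)) ∘ₗ P.goodVal i X))

theorem goodLin_tmul (i : Fin P.n) (X : FGMod (R ⊗[ℂ] S)) (v : P.std i) (y : P.goodMod i X) :
    P.goodLin i X (v ⊗ₜ y) =
      ∑ l, P.coord i v l • (P.u i l 0 ⊗ₜ[ℂ] (1 : S)) • P.goodVal i X y := by
  simp [goodLin]

theorem u_goodLin (i : Fin P.n) (X : FGMod (R ⊗[ℂ] S)) (v : P.std i) (y : P.goodMod i X) (l) :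
    (P.u i 0 l ⊗ₜ[ℂ] (1 : S)) • P.goodLin i X (v ⊗ₜ y) = P.coord i v l • P.goodVal i X y := by
  rw [goodLin_tmul, Finset.smul_sum, Finset.sum_eq_single l]
  · rw [smul_comm]
    exact congrArg _ (((P.goodVal_good i X y).u_smul_u P l l).trans (if_pos rfl))
  · intro m _ hm
    rw [smul_comm]
    exact (congrArg _ (((P.goodVal_good i X y).u_smul_u P l m).trans (if_neg hm.symm))).trans
      (smul_zero (A := X) (P.coord i v m))
  · simp

theorem goodLin_injective (i : Fin P.n) (X : FGMod (R ⊗[ℂ] S)) :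
    Function.Injective (P.goodLin i X) := by
  let h : (Fin (P.d i) → ℂ) ⊗[ℂ] X ≃ₗ[ℂ] (Fin (P.d i) → X) :=
    TensorProduct.comm ℂ _ _ ≪≫ₗ TensorProduct.piScalarRight ℂ ℂ X (Fin (P.d i))
  let g : X →ₗ[ℂ] (Fin (P.d i) → X) :=
    LinearMap.pi fun l => Algebra.lsmul ℂ ℂ X (P.u i 0 l ⊗ₜ[ℂ] (1 : S))
  have key : g ∘ₗ P.goodLin i X = h.toLinearMap ∘ₗ
      TensorProduct.map (P.coord i).toLinearMap (P.goodVal i X) := by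
    ext v y l
    change (P.u i 0 l ⊗ₜ[ℂ] (1 : S)) • P.goodLin i X (v ⊗ₜ y) = _
    rw [u_goodLin]
    simp [h]
  have hinj : Function.Injective (TensorProduct.map (P.coord i).toLinearMap (P.goodVal i X)) := by
    rw [← LinearMap.lTensor_comp_rTensor]
    exact (Module.Flat.lTensor_preserves_injective_linearMap _ (P.goodVal_injective i X)).comp
      (Module.Flat.rTensor_preserves_injective_linearMap _ (P.coord i).injective)
  refine Function.Injective.of_comp (f := g) ?_
  change Function.Injective (g ∘ₗ P.goodLin i X)
  rw [key]
  exact h.injective.comp hinj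

/-- The copy of a tensor product spanned by the good vectors. -/
def goodHom (i : Fin P.n) (X : FGMod (R ⊗[ℂ] S)) :
    (P.std i).ext (P.goodMod i X) →ₗ[R ⊗[ℂ] S] X where
  toFun := P.goodLin i X
  map_add' := map_add _
  map_smul' r z := by
    change P.goodLin i X (extAction _ _ r (show P.std i ⊗[ℂ] P.goodMod i X from z)) =
      r • P.goodLin i X (show P.std i ⊗[ℂ] P.goodMod i X from z)
    generalize (show P.std i ⊗[ℂ] P.goodMod i X from z) = z
    induction r using TensorProduct.induction_on with
    | zero => simp
    | add r s hr hs => rw [map_add, LinearMap.add_apply, map_add, hr, hs, add_smul]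
    | tmul r s =>
      induction z using TensorProduct.induction_on with
      | zero => simp
      | add x y hx hy => rw [map_add, map_add, hx, hy, map_add, smul_add]
      | tmul v y =>
        rw [extAction_tmul, goodLin_tmul, goodLin_tmul]
        have hrs : r ⊗ₜ[ℂ] s = ((1 : R) ⊗ₜ[ℂ] s) * (r ⊗ₜ[ℂ] (1 : S)) := by simp
        simp only [P.coord_smul, Finset.smul_sum, Matrix.mulVec, dotProduct,
          Finset.sum_smul, goodVal_smul]
        rw [Finset.sum_comm]
        refine Finset.sum_congr rfl fun l _ => ?_
        have h := (P.goodVal_good i X y).smul_u P r l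
        change (r ⊗ₜ[ℂ] (1 : S)) • (P.u i l 0 ⊗ₜ[ℂ] (1 : S)) • P.goodVal i X y =
          ∑ m, ((P.φ r i m l • P.u i m 0) ⊗ₜ[ℂ] (1 : S)) • P.goodVal i X y at h
        rw [smul_comm (r ⊗ₜ[ℂ] s), hrs, mul_smul, h, Finset.smul_sum, Finset.smul_sum]
        refine Finset.sum_congr rfl fun m _ => ?_
        rw [← TensorProduct.smul_tmul', smul_assoc, smul_comm _ (P.φ r i m l), smul_smul,
          ← smul_smul_comm, mul_comm, mul_smul, mul_smul, smul_smul_comm]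

theorem ext_surjective : Function.Surjective (G0.ext (R := R) (S := S)) := by
  obtain ⟨P⟩ := exists_split (R := R)
  rw [← AddMonoidHom.range_eq_top, eq_top_iff]
  rintro x -
  induction x using G0.induction with
  | hadd x y hx hy => exact AddSubgroup.add_mem _ hx hy
  | hneg x hx => exact AddSubgroup.neg_mem _ hx
  | hz => exact AddSubgroup.zero_mem _
  | h0 X =>
    refine G0.mk_mem_of_forall _ (fun X hX => ?_) X
    have : Nontrivial (X.res (Algebra.TensorProduct.includeLeft : R →ₐ[ℂ] R ⊗[ℂ] S)) := hX
    obtain ⟨i, x, hx0, hx⟩ := P.exists_good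
      (M := X.res (Algebra.TensorProduct.includeLeft : R →ₐ[ℂ] R ⊗[ℂ] S))
    refine ⟨_, P.goodHom i X, ?_, P.goodLin_injective i X, ⟨_, G0.ext_mk _ _⟩⟩
    have h1 := P.std_nontrivial i
    have h2 : Nontrivial (P.goodMod i X) :=
      ⟨⟨(⟨x, hx⟩ : P.goodSub i X), 0, fun h => hx0 (congrArg Subtype.val h)⟩⟩
    change Nontrivial (P.std i ⊗[ℂ] P.goodMod i X)
    have : FiniteDimensional ℂ (P.std i) := (P.std i).finiteDimensional
    have : FiniteDimensional ℂ (P.goodMod i X) := (P.goodMod i X).finiteDimensional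
    rw [← Module.finrank_pos_iff (R := ℂ), Module.finrank_tensorProduct]
    exact Nat.mul_pos (Module.finrank_pos_iff.2 h1) (Module.finrank_pos_iff.2 h2)
/-- The `S`-module `e X`, for an `R ⊗ S`-module `X` and an idempotent `e` of `R`. -/
def eSub (i : Fin P.n) (X : FGMod (R ⊗[ℂ] S)) :
    Submodule S (X.res (Algebra.TensorProduct.includeRight : S →ₐ[ℂ] R ⊗[ℂ] S)) where
  carrier := {x | (P.e i ⊗ₜ[ℂ] (1 : S)) • (show X from x) = x}
  add_mem' hx hy := (smul_add _ _ _).trans (congrArg₂ _ hx hy)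
  zero_mem' := smul_zero (A := X) (P.e i ⊗ₜ[ℂ] (1 : S))
  smul_mem' s x hx := (smul_smul_comm X (P.e i) s x).trans (congrArg _ hx)

/-- The `S`-module `e X`, for an `R ⊗ S`-module `X` and an idempotent `e` of `R`. -/
def eMod (i : Fin P.n) (X : FGMod (R ⊗[ℂ] S)) : FGMod S :=
  (X.res (Algebra.TensorProduct.includeRight : S →ₐ[ℂ] R ⊗[ℂ] S)).sub (P.eSub i X)

/-- Functoriality of `eMod`. -/
def eMap (i : Fin P.n) {X Y : FGMod (R ⊗[ℂ] S)} (f : X →ₗ[R ⊗[ℂ] S] Y) :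
    P.eMod i X →ₗ[S] P.eMod i Y where
  toFun x := ⟨f x.1, (f.map_smul _ _).symm.trans (congrArg f x.2)⟩
  map_add' x y := Subtype.ext (f.map_add x.1 y.1)
  map_smul' s x := Subtype.ext (f.map_smul ((1 : R) ⊗ₜ[ℂ] s) x.1)

/-- The functor `X ↦ e X` on Grothendieck groups. -/
def eG0 (i : Fin P.n) : G0 (R ⊗[ℂ] S) →+ G0 S :=
  G0.lift (fun X => G0.mk (P.eMod i X)) fun L M N a b ha hab hb =>
    G0.mk_exact (P.eMap i a) (P.eMap i b)
      (fun x y h => Subtype.ext (ha (congrArg Subtype.val h)))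
      (fun y => ⟨fun h => by
          obtain ⟨x, hx⟩ := (hab y.1).1 (congrArg Subtype.val h)
          refine ⟨⟨(P.e i ⊗ₜ[ℂ] (1 : S)) • x, P.e_smul_mem i L x⟩, Subtype.ext ?_⟩
          exact (a.map_smul _ x).trans ((congrArg _ hx).trans y.2), by
          rintro ⟨x, rfl⟩
          exact Subtype.ext ((hab _).2 ⟨x.1, rfl⟩)⟩)
      (fun y => by
        obtain ⟨x, hx⟩ := hb y.1
        refine ⟨⟨(P.e i ⊗ₜ[ℂ] (1 : S)) • x, P.e_smul_mem i M x⟩, Subtype.ext ?_⟩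
        exact (b.map_smul _ x).trans ((congrArg _ hx).trans y.2))

theorem eG0_of_ne {i j : Fin P.n} (h : j ≠ i) (N : FGMod S) :
    P.eG0 i (G0.mk ((P.std j).ext N)) = 0 := by
  rw [eG0, G0.lift_mk]
  have key : ∀ z : P.std j ⊗[ℂ] N, extAction _ _ (P.e i ⊗ₜ[ℂ] (1 : S)) z = 0 := fun z => by
    induction z using TensorProduct.induction_on with
    | zero => simp
    | add x y hx hy => rw [map_add, hx, hy, add_zero]
    | tmul v y => rw [extAction_tmul, P.e_smul_of_ne h, TensorProduct.zero_tmul]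
  have : Subsingleton (P.eMod i ((P.std j).ext N)) :=
    ⟨fun x y => Subtype.ext ((x.2.symm.trans (key x.1)).trans (y.2.symm.trans (key y.1)).symm)⟩
  exact G0.mk_subsingleton _

theorem eG0_self (i : Fin P.n) (N : FGMod S) :
    P.eG0 i (G0.mk ((P.std i).ext N)) = G0.mk N := by
  rw [eG0, G0.lift_mk]
  let ε : P.std i := (P.coord i).symm (Pi.single 0 1)
  have hε : P.coord i ε = Pi.single 0 1 := (P.coord i).apply_symm_apply _
  have heε : ∀ v : P.std i, P.e i • v = P.coord i v 0 • ε := fun v => (P.coord i).injective (by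
    rw [P.coord_e, map_smul, hε]; ext l; simp [Pi.single_apply])
  let c : P.std i ⊗[ℂ] N →ₗ[ℂ] N := (TensorProduct.lid ℂ N).toLinearMap ∘ₗ
    (LinearMap.proj 0 ∘ₗ (P.coord i).toLinearMap).rTensor N
  have hc : ∀ (v : P.std i) (y : N), c (v ⊗ₜ y) = P.coord i v 0 • y := fun v y => by simp [c]
  have key : ∀ z : P.std i ⊗[ℂ] N, extAction _ _ (P.e i ⊗ₜ[ℂ] (1 : S)) z = ε ⊗ₜ c z := fun z => by
    induction z using TensorProduct.induction_on with
    | zero => simp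
    | add x y hx hy => rw [map_add, hx, hy, map_add, TensorProduct.tmul_add]
    | tmul v y => rw [extAction_tmul, heε, hc, one_smul, TensorProduct.smul_tmul]
  have hcε : ∀ y : N, c (ε ⊗ₜ y) = y := fun y => by rw [hc, hε]; simp
  let f : N →ₗ[S] P.eMod i ((P.std i).ext N) :=
    { toFun := fun y => ⟨(ε ⊗ₜ[ℂ] y : P.std i ⊗[ℂ] N),
        (key _).trans (by rw [hcε])⟩
      map_add' := fun x y => Subtype.ext (TensorProduct.tmul_add _ _ _)
      map_smul' := fun s y => Subtype.ext (by
        change ε ⊗ₜ[ℂ] (s • y) = extAction _ _ ((1 : R) ⊗ₜ[ℂ] s) (ε ⊗ₜ[ℂ] y)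
        rw [extAction_tmul, one_smul]) }
  refine (G0.mk_congr (LinearEquiv.ofBijective f ⟨fun x y h => ?_, fun z => ?_⟩)).symm
  · have := congrArg (fun w => c w.1) h
    exact (hcε x).symm.trans (this.trans (hcε y))
  · exact ⟨c z.1, Subtype.ext ((key z.1).symm.trans z.2)⟩

theorem ext_injective : Function.Injective (G0.ext (R := R) (S := S)) := by
  obtain ⟨P⟩ := exists_split (R := R)
  have h1 : ∀ z : G0 R ⊗[ℤ] G0 S, ∃ y : Fin P.n → G0 S, z = ∑ i, G0.mk (P.std i) ⊗ₜ y i := by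
    intro z
    induction z using TensorProduct.induction_on with
    | zero => exact ⟨0, by simp⟩
    | add x y hx hy =>
      obtain ⟨a, rfl⟩ := hx
      obtain ⟨b, rfl⟩ := hy
      exact ⟨a + b, by simp [TensorProduct.tmul_add, Finset.sum_add_distrib]⟩
    | tmul x y =>
      obtain ⟨c, rfl⟩ := P.exists_sum x
      exact ⟨fun i => c i • y, by
        rw [TensorProduct.sum_tmul]
        exact Finset.sum_congr rfl fun i _ => TensorProduct.smul_tmul _ _ _⟩
  have h2 : ∀ i j (y : G0 S), P.eG0 i (G0.ext (G0.mk (P.std j) ⊗ₜ y)) = if j = i then y else 0 := by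
    intro i j y
    induction y using G0.induction with
    | h0 N =>
      rw [G0.ext_mk]
      split_ifs with h
      · subst h; exact P.eG0_self j N
      · exact P.eG0_of_ne h N
    | hadd x y hx hy => rw [TensorProduct.tmul_add, map_add, map_add, hx, hy]; split_ifs <;> simp
    | hneg x hx => rw [TensorProduct.tmul_neg, map_neg, map_neg, hx]; split_ifs <;> simp
    | hz => simp
  rw [injective_iff_map_eq_zero]
  intro z hz
  obtain ⟨y, rfl⟩ := h1 z
  have h3 : ∀ i, y i = 0 := fun i => by
    have := congrArg (P.eG0 i) hz
    rw [map_sum, map_sum, map_zero] at this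
    simpa [h2] using this
  simp [h3]

end Split

variable [FiniteDimensional ℂ R] [FiniteDimensional ℂ S]

/-- The isomorphism `G₀(R) ⊗ G₀(S) ≃ G₀(R ⊗ S)`, `[M] ⊗ [N] ↦ [M ⊗ N]`. -/
def G0.extEquiv : G0 R ⊗[ℤ] G0 S ≃+ G0 (R ⊗[ℂ] S) :=
  AddEquiv.ofBijective G0.ext ⟨Split.ext_injective, Split.ext_surjective⟩

end Kunneth

/-! ### Simple modules, projective covers -/

/-- A complete list (without repetition) of the simple `R`-modules `S i`, together with their
projective covers `P i → S i`. -/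
structure SimpleList (R : Type u) [Ring R] [Algebra ℂ R] where
  ι : Type
  [fintype : Fintype ι]
  S : ι → FGMod R
  P : ι → FGMod R
  simple : ∀ i, IsSimpleModule R (S i)
  distinct : ∀ i j, Nonempty (S i ≃ₗ[R] S j) → i = j
  complete : ∀ M : FGMod R, IsSimpleModule R M → ∃ i, Nonempty (M ≃ₗ[R] S i)
  projective : ∀ i, Module.Projective R (P i)
  π : ∀ i, P i →ₗ[R] S i
  π_surjective : ∀ i, Function.Surjective (π i)
  π_essential : ∀ i (N : Submodule R (P i)), N ⊔ LinearMap.ker (π i) = ⊤ → N = ⊤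

attribute [instance] SimpleList.fintype

/-- The element `β = ∑ᵢ dim(Pᵢ) [Sᵢ]`. -/
def SimpleList.beta {R : Type u} [Ring R] [Algebra ℂ R] (L : SimpleList R) : G0 R :=
  ∑ i, Module.finrank ℂ (L.P i) • G0.mk (L.S i)

/-! ### `q`-twisted Hopf algebras -/

section Twisted

variable {k : Type*} [CommRing k] (q : k) (H : ℕ → Type*) [∀ n, AddCommGroup (H n)]
  [∀ n, Module k (H n)]

/-- The `q`-braiding `v ⊗ w ↦ q ^ (deg v * deg w) w ⊗ v`. -/
def braid : (⨁ n, H n) ⊗[k] (⨁ n, H n) →ₗ[k] (⨁ n, H n) ⊗[k] (⨁ n, H n) :=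
  TensorProduct.lift <| DirectSum.toModule k ℕ _ fun m => LinearMap.flip <|
    DirectSum.toModule k ℕ _ fun n => LinearMap.flip <| q ^ (m * n) •
      (TensorProduct.mk k (⨁ n, H n) (⨁ n, H n)).flip.compl₁₂
        (DirectSum.lof k ℕ H m) (DirectSum.lof k ℕ H n)

theorem braid_lof (m n : ℕ) (x : H m) (y : H n) :
    braid q H (DirectSum.lof k ℕ H m x ⊗ₜ DirectSum.lof k ℕ H n y) =
      q ^ (m * n) • (DirectSum.lof k ℕ H n y ⊗ₜ DirectSum.lof k ℕ H m x) := by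
  simp [braid]

variable {H}

/-- The `q`-twisted product of tensors
`(a ⊗ b) ·_q (a' ⊗ b') = q ^ (deg b * deg a') (a a') ⊗ (b b')`. -/
def twistedMul (mul : (⨁ n, H n) →ₗ[k] (⨁ n, H n) →ₗ[k] (⨁ n, H n)) :
    ((⨁ n, H n) ⊗[k] (⨁ n, H n)) →ₗ[k] ((⨁ n, H n) ⊗[k] (⨁ n, H n)) →ₗ[k]
      ((⨁ n, H n) ⊗[k] (⨁ n, H n)) :=
  let V := ⨁ n, H n
  TensorProduct.curry <|
    TensorProduct.map (TensorProduct.lift mul) (TensorProduct.lift mul) ∘ₗ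
    (TensorProduct.assoc k V V (V ⊗[k] V)).symm.toLinearMap ∘ₗ
    LinearMap.lTensor V ((TensorProduct.assoc k V V V).toLinearMap ∘ₗ
      LinearMap.rTensor V (braid q H) ∘ₗ (TensorProduct.assoc k V V V).symm.toLinearMap) ∘ₗ
    (TensorProduct.assoc k V V (V ⊗[k] V)).toLinearMap

theorem twistedMul_lof (mul : (⨁ n, H n) →ₗ[k] (⨁ n, H n) →ₗ[k] (⨁ n, H n)) (m n : ℕ)
    (a b' : ⨁ n, H n) (b : H m) (a' : H n) :
    twistedMul q mul (a ⊗ₜ DirectSum.lof k ℕ H m b) (DirectSum.lof k ℕ H n a' ⊗ₜ b') =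
      q ^ (m * n) •
        (mul a (DirectSum.lof k ℕ H n a') ⊗ₜ mul (DirectSum.lof k ℕ H m b) b') := by
  simp [twistedMul, braid_lof, TensorProduct.smul_tmul']

/-- `⨁ H n` with product `mul`, unit `one` and coproduct `Δ` is a `q`-twisted Hopf algebra:
a graded connected algebra with a coassociative graded coproduct which is multiplicative for the
`q`-twisted product of tensors. -/
structure IsTwistedHopf (mul : (⨁ n, H n) →ₗ[k] (⨁ n, H n) →ₗ[k] (⨁ n, H n)) (one : H 0)
    (Δ : (⨁ n, H n) →ₗ[k] (⨁ n, H n) ⊗[k] (⨁ n, H n)) : Prop where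
  mul_assoc : ∀ x y z, mul (mul x y) z = mul x (mul y z)
  one_mul : ∀ x, mul (DirectSum.lof k ℕ H 0 one) x = x
  mul_one : ∀ x, mul x (DirectSum.lof k ℕ H 0 one) = x
  mul_mem : ∀ m n (x : H m) (y : H n), mul (DirectSum.lof k ℕ H m x) (DirectSum.lof k ℕ H n y) ∈
    LinearMap.range (DirectSum.lof k ℕ H (m + n))
  connected : Function.Bijective fun c : k => c • one
  comul_mem : ∀ n (x : H n), Δ (DirectSum.lof k ℕ H n x) ∈
    ⨆ p ∈ Finset.HasAntidiagonal.antidiagonal n, LinearMap.range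
      (TensorProduct.map (DirectSum.lof k ℕ H p.1) (DirectSum.lof k ℕ H p.2))
  comul_assoc : ∀ x, TensorProduct.assoc k _ _ _ (LinearMap.rTensor _ Δ (Δ x)) =
    LinearMap.lTensor _ Δ (Δ x)
  comul_mul : ∀ x y, Δ (mul x y) = twistedMul q mul (Δ x) (Δ y)

end Twisted

/-! ### Towers of algebras -/

/-- A tower of algebras: a graded algebra `⨁ alg n` over `ℂ` whose pieces are finite-dimensional
algebras, `alg 0 ≅ ℂ`, such that the external products `ρ` are injective algebra homomorphisms
`alg m ⊗ alg n → alg (m + n)` making `alg (m + n)` projective as a left and as a right module.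
(In `ρ` the degree `m + n` is a variable `p` with `m + n = p`.) -/
structure Tower where
  alg : ℕ → Type u
  [ring : ∀ n, Ring (alg n)]
  [algebra : ∀ n, Algebra ℂ (alg n)]
  [finite : ∀ n, FiniteDimensional ℂ (alg n)]
  alg_zero : Nonempty (alg 0 ≃ₐ[ℂ] ℂ)
  ρ : ∀ {m n p : ℕ}, m + n = p → alg m ⊗[ℂ] alg n →ₐ[ℂ] alg p
  one_ρ : ∀ {n : ℕ} (a : alg n), ρ (zero_add n) (1 ⊗ₜ a) = a
  ρ_one : ∀ {n : ℕ} (a : alg n), ρ (add_zero n) (a ⊗ₜ 1) = a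
  ρ_assoc : ∀ {m n l mn nl p : ℕ} (h₁ : m + n = mn) (h₂ : mn + l = p) (h₃ : n + l = nl)
    (h₄ : m + nl = p) (a : alg m) (b : alg n) (c : alg l),
    ρ h₂ (ρ h₁ (a ⊗ₜ b) ⊗ₜ c) = ρ h₄ (a ⊗ₜ ρ h₃ (b ⊗ₜ c))
  ρ_injective : ∀ {m n p : ℕ} (h : m + n = p), Function.Injective (ρ h)
  left_projective : ∀ {m n p : ℕ} (h : m + n = p),
    letI : Module (alg m ⊗[ℂ] alg n) (alg p) := Module.compHom (alg p) (ρ h).toRingHom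
    Module.Projective (alg m ⊗[ℂ] alg n) (alg p)
  right_projective : ∀ {m n p : ℕ} (h : m + n = p),
    letI : Module (alg m ⊗[ℂ] alg n)ᵐᵒᵖ (alg p) :=
      Module.compHom (alg p) (RingHom.op (ρ h).toRingHom)
    Module.Projective (alg m ⊗[ℂ] alg n)ᵐᵒᵖ (alg p)

attribute [instance] Tower.ring Tower.algebra Tower.finite

/-- A filtered tower of algebras: each `alg n` has a decreasing filtration by left ideals,
starting with `alg n` itself. -/
structure FilteredTower extends Tower.{u} where
  filt : ∀ n, ℕ → Submodule (alg n) (alg n)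
  filt_zero : ∀ n, filt n 0 = ⊤
  filt_anti : ∀ n, Antitone (filt n)

namespace Tower

variable (A : Tower.{u})

/-- The degree `n` part `G₀(Aₙ) ⊗ ℤ[q]` of `G(A)_q`. -/
def Gq (n : ℕ) : Type (u + 1) := ℤ[X] ⊗[ℤ] G0 (A.alg n)

instance (n : ℕ) : AddCommGroup (A.Gq n) :=
  inferInstanceAs (AddCommGroup (ℤ[X] ⊗[ℤ] G0 (A.alg n)))

instance (n : ℕ) : Module ℤ[X] (A.Gq n) :=
  inferInstanceAs (Module ℤ[X] (ℤ[X] ⊗[ℤ] G0 (A.alg n)))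

/-- `G(A)_q` in degree `n` is, by definition, `ℤ[q] ⊗ G₀(Aₙ)`. -/
def gqEquiv (n : ℕ) : ℤ[X] ⊗[ℤ] G0 (A.alg n) ≃ₗ[ℤ[X]] A.Gq n :=
  LinearEquiv.refl ℤ[X] (ℤ[X] ⊗[ℤ] G0 (A.alg n))

/-- `G₀(Aₙ) → G(A)_q`. -/
def incl (n : ℕ) : G0 (A.alg n) →+ ⨁ n, A.Gq n :=
  AddMonoidHom.mk' (fun x => DirectSum.lof ℤ[X] ℕ A.Gq n (A.gqEquiv n (1 ⊗ₜ x))) fun x y => by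
    rw [TensorProduct.tmul_add, map_add, map_add]

/-- The unit of `G(A)_q`: the class of the regular `A₀`-module, `A₀ ≅ ℂ`. -/
def one : A.Gq 0 := A.gqEquiv 0 (1 ⊗ₜ G0.mk (FGMod.of (A.alg 0) (A.alg 0)))

/-- The component `G₀(Aₙ) → G₀(Aₖ) ⊗ G₀(Aₗ)` of the coproduct: restriction to `Aₖ ⊗ Aₗ`. -/
def comulComponent {k l n : ℕ} (h : k + l = n) :
    G0 (A.alg n) →+ G0 (A.alg k) ⊗[ℤ] G0 (A.alg l) :=
  (G0.extEquiv (R := A.alg k) (S := A.alg l)).symm.toAddMonoidHom.comp (G0.res (A.ρ h))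

/-- `G₀(Aₖ) ⊗ G₀(Aₗ) → G(A)_q ⊗ G(A)_q`. -/
def inclTensor (k l : ℕ) :
    G0 (A.alg k) ⊗[ℤ] G0 (A.alg l) →+ (⨁ n, A.Gq n) ⊗[ℤ[X]] (⨁ n, A.Gq n) :=
  TensorProduct.liftAddHom
    (AddMonoidHom.mk' (fun x =>
      (TensorProduct.mk ℤ[X] (⨁ n, A.Gq n) (⨁ n, A.Gq n) (A.incl k x)).toAddMonoidHom.comp
        (A.incl l)) fun x y => by ext; simp)
    fun r x y => by rw [map_zsmul, map_zsmul, AddMonoidHom.zsmul_apply]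

/-- The usual coproduct `Δ[N] = ∑_{k + l = n} [Res N]`, extended `ℤ[q]`-linearly. -/
def comul : (⨁ n, A.Gq n) →ₗ[ℤ[X]] (⨁ n, A.Gq n) ⊗[ℤ[X]] (⨁ n, A.Gq n) :=
  DirectSum.toModule ℤ[X] ℕ _ fun n => LinearMap.liftBaseChange ℤ[X] (AddMonoidHom.toIntLinearMap
    (∑ p : Finset.HasAntidiagonal.antidiagonal n, (A.inclTensor p.1.1 p.1.2).comp
      (A.comulComponent (Finset.HasAntidiagonal.mem_antidiagonal.1 p.2)))) ∘ₗ
    (A.gqEquiv n).symm.toLinearMap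

theorem comul_incl (n : ℕ) (x : G0 (A.alg n)) : A.comul (A.incl n x) =
    ∑ p : Finset.HasAntidiagonal.antidiagonal n, A.inclTensor p.1.1 p.1.2
      (A.comulComponent (Finset.HasAntidiagonal.mem_antidiagonal.1 p.2) x) := by
  simp [comul, incl]

theorem inclTensor_tmul (k l : ℕ) (x : G0 (A.alg k)) (y : G0 (A.alg l)) :
    A.inclTensor k l (x ⊗ₜ y) = A.incl k x ⊗ₜ A.incl l y := by
  simp [inclTensor]

/-- Specialization at `q = 1`. -/
def specialize : (⨁ n, A.Gq n) →+ ⨁ n, G0 (A.alg n) :=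
  DirectSum.map fun n => (TensorProduct.liftAddHom
    (AddMonoidHom.mk' (fun p => AddMonoidHom.mk' (fun x => p.eval 1 • x) fun x y => smul_add _ _ _)
      fun p p' => by ext; simp [add_smul])
    fun r p x => by simp [mul_smul, smul_comm r]).comp (A.gqEquiv n).symm.toAddMonoidHom

theorem specialize_lof (n : ℕ) (p : ℤ[X]) (x : G0 (A.alg n)) :
    A.specialize (DirectSum.lof ℤ[X] ℕ A.Gq n (A.gqEquiv n (p ⊗ₜ x))) =
      DirectSum.of (fun n => G0 (A.alg n)) n (p.eval 1 • x) := by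
  simp [specialize, DirectSum.lof_eq_of, DirectSum.map_of]

/-- A product on `G(A)_q` quantizes `G(A)` if at `q = 1` it reduces to the usual product
`[M] [N] = [Ind (M ⊗ N)]`. -/
def Quantizes (mul : (⨁ n, A.Gq n) →ₗ[ℤ[X]] (⨁ n, A.Gq n) →ₗ[ℤ[X]] (⨁ n, A.Gq n)) : Prop :=
  ∀ (m n : ℕ) (M : FGMod (A.alg m)) (N : FGMod (A.alg n)),
    A.specialize (mul (A.incl m (G0.mk M)) (A.incl n (G0.mk N))) =
      DirectSum.of (fun n => G0 (A.alg n)) (m + n) (G0.mk ((M.ext N).ind (A.ρ rfl)))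

/-- The powers of an element for a product on `G(A)_q`. -/
def starPow (mul : (⨁ n, A.Gq n) →ₗ[ℤ[X]] (⨁ n, A.Gq n) →ₗ[ℤ[X]] (⨁ n, A.Gq n))
    (x : ⨁ n, A.Gq n) : ℕ → ⨁ n, A.Gq n
  | 0 => DirectSum.lof ℤ[X] ℕ A.Gq 0 A.one
  | n + 1 => mul x (starPow mul x n)

end Tower

namespace FilteredTower

variable (A : FilteredTower.{u})

/-- The subquotient `Aₙ⁽ⁱ⁾ / Aₙ⁽ⁱ⁺¹⁾`. -/
def gr (n i : ℕ) : FGMod (A.alg n) :=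
  ((FGMod.of (A.alg n) (A.alg n)).sub (A.filt n i)).quot
    ((A.filt n (i + 1)).submoduleOf (A.filt n i))

theorem eventually_subsingleton_gr (n : ℕ) : ∃ N, ∀ i ≥ N, Subsingleton (A.gr n i) := by
  have : IsArtinianRing (A.alg n) := IsArtinianRing.of_finite ℂ (A.alg n)
  obtain ⟨N, hN⟩ := IsArtinian.monotone_stabilizes
    (⟨fun i => OrderDual.toDual (A.filt n i), fun i j h => A.filt_anti n h⟩ : ℕ →o _)
  refine ⟨N, fun i hi => ?_⟩
  have h : A.filt n i = A.filt n (i + 1) := (hN i hi).symm.trans (hN (i + 1) (by omega))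
  refine Submodule.Quotient.subsingleton_iff.2 ?_
  rw [← h]
  exact Submodule.submoduleOf_self _

/-- The graded character `[Aₙ]_q = ∑ᵢ qⁱ [Aₙ⁽ⁱ⁾ / Aₙ⁽ⁱ⁺¹⁾]` (a finite sum). -/
def gradedChar (n : ℕ) : ⨁ n, A.Gq n :=
  ∑ᶠ i : ℕ, (Polynomial.X : ℤ[X]) ^ i • A.incl n (G0.mk (A.gr n i))

/-- The graded dimension `dim_q Aₙ = ∑ᵢ qⁱ dim (Aₙ⁽ⁱ⁾ / Aₙ⁽ⁱ⁺¹⁾)` (a finite sum). -/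
def gradedDim (n : ℕ) : ℤ[X] :=
  ∑ᶠ i : ℕ, (Polynomial.X : ℤ[X]) ^ i * (Module.finrank ℂ (A.gr n i) : ℤ[X])

end FilteredTower

/-- The `q`-analogue `[n] = 1 + q + ⋯ + q ^ (n - 1)`. -/
def qNat (n : ℕ) : ℤ[X] := ∑ j ∈ Finset.range n, Polynomial.X ^ j

/-- The `q`-factorial `[n]! = [n] [n - 1] ⋯ [1]`. -/
def qFactorial (n : ℕ) : ℤ[X] := ∏ j ∈ Finset.range n, qNat (j + 1)

end FilteredTowers

end

/-! The proof differentiates powers of `β`. Let `D` be the coproduct followed by contraction of its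
first tensor factor with the ordinary dimension in degree one; in Lean, `A.contract 1` after
`A.comul`. Two properties of `D` give a recursion for the `q`-dimension.

Restriction does not change dimensions, and dimension is multiplicative on external tensor products.
Hence `D` lowers the degree by one but preserves the `q`-dimension in every positive degree
(`dimq_contract_comul_lof`).

Elements `x` of degree one are primitive (`comul_incl_one`). The twisted multiplicativity of the
coproduct therefore becomes a `q`-Leibniz rule `D (x * y) = dim x • y + q • x * D y`
(`contract_one_twistedMul`). As for the `q`-derivative of a monomial, it follows that `D` sends the
power `n + 1` of `x` to `dim x * [n + 1]` times its power `n` (`contract_one_comul_starPow`).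

Taking dimensions, the `q`-dimension of the `n`-th power is `(dim x) ^ n * [n]!`. For `x = β` one
has `dim β = ∑ dim Pᵢ * dim Sᵢ = dim A₁`, because the regular module is the sum of the `Pᵢ`, each
repeated `dim Sᵢ` times (`SimpleList.sum_finrank_mul_finrank`). By (Q3) the power of `β` is the
graded character, whose `q`-dimension is the graded dimension. -/

namespace FilteredTowers

/-! ### Radicals, superfluous submodules and projective covers. -/

section ProjectiveCovers

variable {R : Type*} [Ring R] {X Y Z : Type*} [AddCommGroup X] [Module R X] [AddCommGroup Y]
  [Module R Y] [AddCommGroup Z] [Module R Z]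

/-- Nakayama's lemma: the Jacobson radical is superfluous. -/
theorem eq_top_of_sup_eq_top [IsCoatomic (Submodule R X)] {N K : Submodule R X}
    (hK : K ≤ Module.jacobson R X) (h : N ⊔ K = ⊤) : N = ⊤ := by
  refine (eq_top_or_exists_le_coatom N).resolve_right ?_
  rintro ⟨m, hm, hN⟩
  exact hm.1 (top_le_iff.1 (h ▸ sup_le hN (hK.trans (sInf_le hm))))

/-- A maximal submodule not containing `K` would together with `K` span everything, against
superfluity; so `K` lies in every maximal submodule. -/
theorem le_jacobson_of_superfluous {K : Submodule R X}
    (h : ∀ N : Submodule R X, N ⊔ K = ⊤ → N = ⊤) : K ≤ Module.jacobson R X := by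
  refine le_sInf fun m hm => ?_
  by_contra hle
  exact hm.1 (h m (hm.2 _ (left_lt_sup.2 hle)))

/-- Projective covers are unique. -/
theorem nonempty_linearEquiv_of_projective [Module.Projective R X] [Module.Projective R Y]
    [IsCoatomic (Submodule R X)] [IsCoatomic (Submodule R Y)] (h : X →ₗ[R] Z) (g : Y →ₗ[R] Z)
    (hh : Function.Surjective h) (hg : Function.Surjective g)
    (hX : LinearMap.ker h ≤ Module.jacobson R X) (hY : LinearMap.ker g ≤ Module.jacobson R Y) :
    Nonempty (X ≃ₗ[R] Y) := by
  obtain ⟨f, hf⟩ := Module.projective_lifting_property g h hg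
  have hf' : ∀ x, g (f x) = h x := fun x => LinearMap.congr_fun hf x
  have hfs : Function.Surjective f := by
    rw [← LinearMap.range_eq_top]
    -- The range of `f` already covers `Z`, so it fills `Y` up to the superfluous `ker g`.
    refine eq_top_of_sup_eq_top hY (eq_top_iff.2 fun y _ => ?_)
    obtain ⟨x, hx⟩ := hh (g y)
    exact Submodule.mem_sup.2 ⟨f x, ⟨x, rfl⟩, y - f x, by simp [hf', hx], by simp⟩
  -- Projectivity of `Y` splits `f`. The section `s` is injective, and Nakayama in `X` makes it
  -- surjective: `x` and `s (f x)` have the same image under `h`.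
  obtain ⟨s, hs⟩ := Module.projective_lifting_property f LinearMap.id hfs
  have hs' : ∀ y, f (s y) = y := fun y => LinearMap.congr_fun hs y
  refine ⟨(LinearEquiv.ofBijective s ⟨Function.LeftInverse.injective hs', ?_⟩).symm⟩
  rw [← LinearMap.range_eq_top]
  refine eq_top_of_sup_eq_top hX (eq_top_iff.2 fun x _ => ?_)
  exact Submodule.mem_sup.2 ⟨s (f x), ⟨f x, rfl⟩, x - s (f x), by simp [← hf', hs'], by simp⟩

/-- Linear maps carry radicals into radicals; apply this to the coordinate embeddings, of whose
images `x` is a finite sum. -/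
theorem mem_jacobson_pi {κ : Type*} [Finite κ] {M : κ → Type*} [∀ k, AddCommGroup (M k)]
    [∀ k, Module R (M k)] {x : ∀ k, M k} (hx : ∀ k, x k ∈ Module.jacobson R (M k)) :
    x ∈ Module.jacobson R (∀ k, M k) := by
  classical
  have := Fintype.ofFinite κ
  rw [← Finset.univ_sum_single x]
  exact Submodule.sum_mem _ fun k _ =>
    Module.le_comap_jacobson (LinearMap.single R M k) (hx k)

end ProjectiveCovers

/-! ### Decomposition of the regular module and its dimension. -/

namespace SimpleList

variable {R : Type u} [Ring R] [Algebra ℂ R] (L : SimpleList R)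

attribute [local instance] SimpleList.simple SimpleList.projective

/-- The multiplicities of the simple modules in the top of the regular module. -/
theorem exists_top [FiniteDimensional ℂ R] : ∃ (n : ℕ) (σ : Fin n → L.ι) (h : R →ₗ[R] ∀ k, L.S (σ k)),
    Function.Surjective h ∧ LinearMap.ker h = Module.jacobson R R := by
  have : IsArtinianRing R := IsArtinianRing.of_finite ℂ R
  -- Over an Artinian ring, the quotient by the radical is semisimple; its simple summands are then
  -- matched with the given list by completeness.
  have : IsSemisimpleModule R (R ⧸ Module.jacobson R R) :=
    (IsArtinian.isSemisimpleModule_iff_jacobson R _).2 (Module.jacobson_quotient_jacobson R R)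
  obtain ⟨n, S, e, hs⟩ :=
    IsSemisimpleModule.exists_linearEquiv_fin_dfinsupp R (R ⧸ Module.jacobson R R)
  have hc : ∀ k, ∃ i, Nonempty (S k ≃ₗ[R] L.S i) := fun k => by
    have : FiniteDimensional ℂ (S k) :=
      inferInstanceAs (FiniteDimensional ℂ ((S k).restrictScalars ℂ))
    have : Module.Finite R (S k) := Module.Finite.of_restrictScalars_finite ℂ R _
    exact L.complete (FGMod.of R (S k)) (hs k)
  choose σ τ using hc
  let e' := e ≪≫ₗ DFinsupp.linearEquivFunOnFintype ≪≫ₗ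
    LinearEquiv.piCongrRight fun k => (τ k).some
  exact ⟨n, σ, e'.toLinearMap ∘ₗ (Module.jacobson R R).mkQ,
    e'.surjective.comp (Submodule.mkQ_surjective _), by simp [LinearMap.ker_comp]⟩

/-- Both modules are projective covers of the same semisimple top, hence isomorphic. -/
theorem nonempty_linearEquiv_pi {n : ℕ} {σ : Fin n → L.ι} {h : R →ₗ[R] ∀ k, L.S (σ k)}
    (hs : Function.Surjective h) (hk : LinearMap.ker h = Module.jacobson R R) :
    Nonempty (R ≃ₗ[R] ∀ k, L.P (σ k)) := by
  have : Module.Projective R (∀ k, L.P (σ k)) :=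
    .of_equiv (DFinsupp.linearEquivFunOnFintype (R := R) (M := fun k => L.P (σ k)))
  refine nonempty_linearEquiv_of_projective h (LinearMap.piMap fun k => L.π (σ k)) hs
    (Function.Surjective.piMap fun k => L.π_surjective (σ k)) hk.le fun x hx => ?_
  refine mem_jacobson_pi fun k => le_jacobson_of_superfluous (L.π_essential (σ k)) ?_
  exact congrFun hx k

/-- Schur's lemma: endomorphisms of a finite-dimensional simple module over `ℂ` are scalars, and a
nonzero map between two listed modules is an isomorphism, which forces equal indices. -/
theorem finrank_hom [FiniteDimensional ℂ R] [DecidableEq L.ι] (i j : L.ι) :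
    Module.finrank ℂ (L.S j →ₗ[R] L.S i) = if j = i then 1 else 0 := by
  split_ifs with h
  · subst h
    have : FiniteDimensional ℂ (L.S j) := (L.S j).finiteDimensional
    have hb := IsSimpleModule.algebraMap_end_bijective_of_isAlgClosed (A := R) (V := L.S j) ℂ
    rw [← (LinearEquiv.ofBijective (Algebra.linearMap ℂ (Module.End R (L.S j))) hb).finrank_eq,
      Module.finrank_self]
  · have : Subsingleton (L.S j →ₗ[R] L.S i) := ⟨fun f g => by
      have : ∀ f : L.S j →ₗ[R] L.S i, f = 0 := fun f =>
        (LinearMap.bijective_or_eq_zero f).resolve_left fun hf =>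
          h (L.distinct j i ⟨LinearEquiv.ofBijective f hf⟩)
      rw [this f, this g]⟩
    exact Module.finrank_zero_of_subsingleton

/-- A simple module occurs in the top of the regular module as often as its dimension says. -/
theorem card_fiber [FiniteDimensional ℂ R] [DecidableEq L.ι] {n : ℕ} {σ : Fin n → L.ι} {h : R →ₗ[R] ∀ k, L.S (σ k)}
    (hs : Function.Surjective h) (hk : LinearMap.ker h = Module.jacobson R R) (i : L.ι) :
    ∑ k, (if σ k = i then 1 else 0) = Module.finrank ℂ (L.S i) := by
  have : FiniteDimensional ℂ (L.S i) := (L.S i).finiteDimensional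
  -- Count `Hom(R, Sᵢ)` in two ways. It is `Sᵢ` itself; and, since maps to a simple module kill the
  -- radical, it is also the space of maps from the top, where Schur's lemma counts the summands
  -- `Sᵢ`.
  let c : ((∀ k, L.S (σ k)) →ₗ[R] L.S i) →ₗ[ℂ] (R →ₗ[R] L.S i) :=
    { toFun := fun f => f ∘ₗ h
      map_add' := fun _ _ => rfl
      map_smul' := fun _ _ => rfl }
  have hc : Function.Bijective c := by
    refine ⟨fun f g hfg => ?_, fun f => ?_⟩
    · refine LinearMap.ext fun x => ?_
      obtain ⟨y, rfl⟩ := hs x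
      exact LinearMap.congr_fun hfg y
    · have hle : LinearMap.ker h ≤ LinearMap.ker f :=
        hk.le.trans (IsSemisimpleModule.jacobson_le_ker _ _ _ _ f)
      refine ⟨(LinearMap.ker h).liftQ f hle ∘ₗ
        (h.quotKerEquivOfSurjective hs).symm.toLinearMap, ?_⟩
      ext
      change (LinearMap.ker h).liftQ f hle ((h.quotKerEquivOfSurjective hs).symm (h 1)) = f 1
      rw [LinearMap.quotKerEquivOfSurjective_symm_apply, Submodule.liftQ_apply]
  have h1 := (LinearEquiv.ofBijective c hc).finrank_eq
  rw [(LinearMap.ringLmapEquivSelf R ℂ (L.S i)).finrank_eq,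
    ← (LinearMap.lsum R (fun k => L.S (σ k)) ℂ).finrank_eq] at h1
  have hfin : ∀ k, FiniteDimensional ℂ (L.S (σ k) →ₗ[R] L.S i) := fun k => by
    have : FiniteDimensional ℂ (L.S (σ k)) := (L.S (σ k)).finiteDimensional
    infer_instance
  rw [← h1, Module.finrank_pi_fintype]
  exact Finset.sum_congr rfl fun k _ => (L.finrank_hom i (σ k)).symm

/-- `dim R = ∑ᵢ dim(Pᵢ) dim(Sᵢ)`. -/
theorem sum_finrank_mul_finrank [FiniteDimensional ℂ R] :
    ∑ i, Module.finrank ℂ (L.P i) * Module.finrank ℂ (L.S i) = Module.finrank ℂ R := by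
  classical
  obtain ⟨n, σ, h, hs, hk⟩ := L.exists_top
  obtain ⟨e⟩ := L.nonempty_linearEquiv_pi hs hk
  have : ∀ i, FiniteDimensional ℂ (L.P i) := fun i => (L.P i).finiteDimensional
  rw [(e.restrictScalars ℂ).finrank_eq, Module.finrank_pi_fintype]
  -- Writing `dim Sᵢ` as the size of the fibre of `σ` over `i` turns the sum over `i` into the sum
  -- over all summands.
  simp only [← L.card_fiber hs hk, Finset.mul_sum]
  rw [Finset.sum_comm]
  simp

end SimpleList

end FilteredTowers


namespace FilteredTowers

/-! ### Dimension on Grothendieck groups. -/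

namespace G0

variable {R S T : Type u} [Ring R] [Algebra ℂ R] [Ring S] [Algebra ℂ S] [Ring T] [Algebra ℂ T]

/-- The dimension, as a function on the Grothendieck group. -/
noncomputable def dim [FiniteDimensional ℂ R] : G0 R →+ ℤ :=
  lift (fun M => (Module.finrank ℂ M : ℤ)) fun L M N f g hf hfg hg => by
    have : FiniteDimensional ℂ M := M.finiteDimensional
    -- Additivity is rank-nullity for `g`, with `ker g` identified with `L` by exactness.
    have h := (g.restrictScalars ℂ).finrank_range_add_finrank_ker
    have hfg' : Function.Exact (f.restrictScalars ℂ) (g.restrictScalars ℂ) := hfg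
    rw [LinearMap.range_eq_top.2 (show Function.Surjective (g.restrictScalars ℂ) from hg),
      finrank_top, LinearMap.exact_iff.1 hfg',
      LinearMap.finrank_range_of_inj (f := f.restrictScalars ℂ) hf] at h
    rw [← h, Nat.cast_add, add_comm]

theorem dim_mk [FiniteDimensional ℂ R] (M : FGMod R) : dim (mk M) = Module.finrank ℂ M :=
  lift_mk _ _ M

theorem dim_res [FiniteDimensional ℂ R] [FiniteDimensional ℂ T] (f : R →ₐ[ℂ] T) (x : G0 T) :
    dim (res f x) = dim x :=
  DFunLike.congr_fun (f := dim.comp (res f)) (g := dim)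
    (hom_ext fun M => by simp only [AddMonoidHom.comp_apply, res, lift_mk, dim_mk]; rfl) x

theorem dim_ext_tmul [FiniteDimensional ℂ R] [FiniteDimensional ℂ S] (x : G0 R) (y : G0 S) :
    dim (ext (x ⊗ₜ y)) = dim x * dim y := by
  induction x using G0.induction with
  | h0 M =>
    induction y using G0.induction with
    | h0 N =>
      rw [ext_mk, dim_mk, dim_mk, dim_mk, ← Nat.cast_mul]
      exact congrArg _ (Module.finrank_tensorProduct (R := ℂ) (S := ℂ) (M := M) (M' := N))
    | hadd x y hx hy => rw [TensorProduct.tmul_add, map_add, map_add, hx, hy, map_add, mul_add]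
    | hneg x hx => rw [TensorProduct.tmul_neg, map_neg, map_neg, hx, map_neg, mul_neg]
    | hz => simp
  | hadd x y hx hy => rw [TensorProduct.add_tmul, map_add, map_add, hx, hy, map_add, add_mul]
  | hneg x hx => rw [TensorProduct.neg_tmul, map_neg, map_neg, hx, map_neg, neg_mul]
  | hz => simp

end G0

/-- This is where the coefficients `dim Pᵢ` of `β` matter: they produce the base `r` of the power in
the final formula. -/
theorem SimpleList.dim_beta {R : Type u} [Ring R] [Algebra ℂ R] [FiniteDimensional ℂ R]
    (L : SimpleList R) : G0.dim L.beta = Module.finrank ℂ R := by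
  rw [← L.sum_finrank_mul_finrank]
  simp [SimpleList.beta, G0.dim_mk]

/-- The shape of the `q`-Leibniz rule: `1` from the leading factor, `q` times the contribution of
the others. -/
theorem qNat_succ (n : ℕ) : qNat (n + 1) = 1 + Polynomial.X * qNat n := by
  simp only [qNat, Finset.sum_range_succ' _ n, Finset.mul_sum, pow_succ']
  ring

namespace Tower

variable (A : Tower.{u})

/-- The class of the one-dimensional `A₀`-module. -/
noncomputable def triv : G0 (A.alg 0) := G0.mk (FGMod.of (A.alg 0) (A.alg 0))

theorem incl_triv : A.incl 0 A.triv = DirectSum.lof ℤ[X] ℕ A.Gq 0 A.one := rfl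

theorem dim_triv : G0.dim A.triv = 1 := by
  obtain ⟨φ⟩ := A.alg_zero
  rw [triv, G0.dim_mk]
  exact_mod_cast φ.toLinearEquiv.finrank_eq.trans (Module.finrank_self ℂ)

/-! ### Degree-zero restriction and primitivity in degree one. -/

section Counit

variable (φ : A.alg 0 ≃ₐ[ℂ] ℂ)

theorem eq_smul_one (a : A.alg 0) : a = φ a • (1 : A.alg 0) :=
  φ.injective (by simp)

theorem ρ_left {n : ℕ} (r : A.alg 0) (s : A.alg n) : A.ρ (zero_add n) (r ⊗ₜ s) = φ r • s := by
  conv_lhs => rw [A.eq_smul_one φ r]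
  rw [← TensorProduct.smul_tmul', map_smul, A.one_ρ]

theorem ρ_right {n : ℕ} (r : A.alg 0) (s : A.alg n) : A.ρ (add_zero n) (s ⊗ₜ r) = φ r • s := by
  conv_lhs => rw [A.eq_smul_one φ r]
  rw [TensorProduct.tmul_smul, map_smul, A.ρ_one]

end Counit

/-- Through `ρ`, an element of `A₀` acts as the scalar `φ` assigns to it, so `a ⊗ y ↦ φ a • y`
intertwines the two actions. This identifies the edge component of the coproduct. -/
theorem res_left {n : ℕ} (N : FGMod (A.alg n)) :
    G0.mk (N.res (A.ρ (zero_add n))) =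
      G0.mk ((FGMod.of (A.alg 0) (A.alg 0)).ext N) := by
  obtain ⟨φ⟩ := A.alg_zero
  let e : A.alg 0 ⊗[ℂ] N ≃ₗ[ℂ] N :=
    TensorProduct.congr φ.toLinearEquiv (LinearEquiv.refl ℂ N) ≪≫ₗ TensorProduct.lid ℂ N
  have he : ∀ a y, e (a ⊗ₜ y) = φ a • y := fun a y => by simp [e]
  have key : ∀ (r : A.alg 0 ⊗[ℂ] A.alg n) (z : A.alg 0 ⊗[ℂ] N),
      e (FGMod.extAction (FGMod.of (A.alg 0) (A.alg 0)) N r z) = A.ρ (zero_add n) r • e z := by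
    intro r z
    induction r using TensorProduct.induction_on with
    | zero => simp
    | add r s hr hs => rw [map_add, LinearMap.add_apply, map_add, hr, hs, map_add, add_smul]
    | tmul r s =>
      induction z using TensorProduct.induction_on with
      | zero => simp
      | add x y hx hy => rw [map_add, map_add, hx, hy, map_add, smul_add]
      | tmul v y =>
        rw [FGMod.extAction_tmul, A.ρ_left φ]
        erw [he, he]
        rw [smul_eq_mul, map_mul, smul_assoc, mul_smul, smul_comm s (φ v)]
  exact (G0.mk_congr (M := (FGMod.of (A.alg 0) (A.alg 0)).ext N) (N := N.res (A.ρ (zero_add n)))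
    { toFun := e, map_add' := e.map_add, map_smul' := key, invFun := e.symm
      left_inv := e.left_inv, right_inv := e.right_inv }).symm

theorem res_right {n : ℕ} (N : FGMod (A.alg n)) :
    G0.mk (N.res (A.ρ (add_zero n))) =
      G0.mk (N.ext (FGMod.of (A.alg 0) (A.alg 0))) := by
  obtain ⟨φ⟩ := A.alg_zero
  let e : N ⊗[ℂ] A.alg 0 ≃ₗ[ℂ] N :=
    TensorProduct.congr (LinearEquiv.refl ℂ N) φ.toLinearEquiv ≪≫ₗ TensorProduct.rid ℂ N
  have he : ∀ a y, e (y ⊗ₜ a) = φ a • y := fun a y => by simp [e]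
  have key : ∀ (r : A.alg n ⊗[ℂ] A.alg 0) (z : N ⊗[ℂ] A.alg 0),
      e (FGMod.extAction N (FGMod.of (A.alg 0) (A.alg 0)) r z) = A.ρ (add_zero n) r • e z := by
    intro r z
    induction r using TensorProduct.induction_on with
    | zero => simp
    | add r s hr hs => rw [map_add, LinearMap.add_apply, map_add, hr, hs, map_add, add_smul]
    | tmul s r =>
      induction z using TensorProduct.induction_on with
      | zero => simp
      | add x y hx hy => rw [map_add, map_add, hx, hy, map_add, smul_add]
      | tmul y v =>
        rw [FGMod.extAction_tmul, A.ρ_right φ]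
        erw [he, he]
        rw [smul_eq_mul, map_mul, smul_assoc, mul_smul, smul_comm s (φ v)]
  exact (G0.mk_congr (M := N.ext (FGMod.of (A.alg 0) (A.alg 0))) (N := N.res (A.ρ (add_zero n)))
    { toFun := e, map_add' := e.map_add, map_smul' := key, invFun := e.symm
      left_inv := e.left_inv, right_inv := e.right_inv }).symm

theorem ext_comulComponent {k l n : ℕ} (h : k + l = n) (x : G0 (A.alg n)) :
    G0.ext (A.comulComponent h x) = G0.res (A.ρ h) x :=
  G0.extEquiv.apply_symm_apply _

/-- The component is defined by inverting `G0.extEquiv`; after applying that isomorphism, the claim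
is `res_left`. -/
theorem comulComponent_left {n : ℕ} (h : 0 + n = n) (x : G0 (A.alg n)) :
    A.comulComponent h x = A.triv ⊗ₜ x := by
  refine G0.extEquiv.injective ((A.ext_comulComponent h x).trans ?_)
  refine DFunLike.congr_fun (f := G0.res (A.ρ h)) (g := G0.ext.comp
    (TensorProduct.mk ℤ (G0 (A.alg 0)) (G0 (A.alg n)) A.triv).toAddMonoidHom)
    (G0.hom_ext fun N => ?_) x
  rw [G0.res, G0.lift_mk]
  exact (A.res_left N).trans (G0.ext_mk _ _).symm

theorem comulComponent_right {n : ℕ} (h : n + 0 = n) (x : G0 (A.alg n)) :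
    A.comulComponent h x = x ⊗ₜ A.triv := by
  refine G0.extEquiv.injective ((A.ext_comulComponent h x).trans ?_)
  refine DFunLike.congr_fun (f := G0.res (A.ρ h)) (g := G0.ext.comp
    ((TensorProduct.mk ℤ (G0 (A.alg n)) (G0 (A.alg 0))).flip A.triv).toAddMonoidHom)
    (G0.hom_ext fun N => ?_) x
  rw [G0.res, G0.lift_mk]
  exact (A.res_right N).trans (G0.ext_mk _ _).symm

/-- The elements of degree one are primitive. -/
theorem comul_incl_one (x : G0 (A.alg 1)) : A.comul (A.incl 1 x) =
    A.incl 0 A.triv ⊗ₜ A.incl 1 x + A.incl 1 x ⊗ₜ A.incl 0 A.triv := by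
  rw [comul_incl, show (Finset.univ : Finset (Finset.HasAntidiagonal.antidiagonal 1)) =
    {⟨(0, 1), by simp⟩, ⟨(1, 0), by simp⟩} by decide, Finset.sum_pair (by decide)]
  congr 1
  · change A.inclTensor 0 1 (A.comulComponent (zero_add 1) x) = _
    rw [comulComponent_left, inclTensor_tmul]
  · change A.inclTensor 1 0 (A.comulComponent (add_zero 1) x) = _
    rw [comulComponent_right, inclTensor_tmul]

/-! ### The `q`-dimension and contractions of the coproduct. -/

/-- The dimension on `G₀(Aₙ) ⊗ ℤ[q]`. -/
noncomputable def dimGq (n : ℕ) : A.Gq n →ₗ[ℤ[X]] ℤ[X] :=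
  LinearMap.liftBaseChange ℤ[X]
    ((Int.castAddHom ℤ[X]).comp (G0.dim (R := A.alg n))).toIntLinearMap ∘ₗ
    (A.gqEquiv n).symm.toLinearMap

/-- The `q`-dimension on `G(A)_q`. -/
noncomputable def dimq : (⨁ n, A.Gq n) →ₗ[ℤ[X]] ℤ[X] :=
  DirectSum.toModule ℤ[X] ℕ _ A.dimGq

/-- The `q`-dimension of the component of degree `j`. -/
noncomputable def dimqComponent (j : ℕ) : (⨁ n, A.Gq n) →ₗ[ℤ[X]] ℤ[X] :=
  A.dimGq j ∘ₗ DirectSum.component ℤ[X] ℕ A.Gq j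

theorem dimq_incl (n : ℕ) (x : G0 (A.alg n)) : A.dimq (A.incl n x) = (G0.dim x : ℤ[X]) := by
  simp [dimq, incl, dimGq]

theorem dimqComponent_lof_self (j : ℕ) (x : A.Gq j) :
    A.dimqComponent j (DirectSum.lof ℤ[X] ℕ A.Gq j x) = A.dimGq j x := by
  simp [dimqComponent, DirectSum.component.lof_self]

theorem dimqComponent_lof_of_ne {j k : ℕ} (h : k ≠ j) (x : A.Gq k) :
    A.dimqComponent j (DirectSum.lof ℤ[X] ℕ A.Gq k x) = 0 := by
  rw [dimqComponent, LinearMap.comp_apply, DirectSum.component.of, dif_neg h, map_zero]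

theorem dimqComponent_incl_self (j : ℕ) (x : G0 (A.alg j)) :
    A.dimqComponent j (A.incl j x) = (G0.dim x : ℤ[X]) :=
  (A.dimqComponent_lof_self j _).trans (by simp [dimGq])

theorem dimqComponent_incl_of_ne {j k : ℕ} (h : k ≠ j) (x : G0 (A.alg k)) :
    A.dimqComponent j (A.incl k x) = 0 :=
  A.dimqComponent_lof_of_ne h _

/-- Contraction of the first tensor factor with the `q`-dimension in degree `j`. -/
noncomputable def contract (j : ℕ) :
    (⨁ n, A.Gq n) ⊗[ℤ[X]] (⨁ n, A.Gq n) →ₗ[ℤ[X]] ⨁ n, A.Gq n :=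
  (TensorProduct.lid ℤ[X] _).toLinearMap ∘ₗ (A.dimqComponent j).rTensor _

theorem contract_tmul (j : ℕ) (x y : ⨁ n, A.Gq n) :
    A.contract j (x ⊗ₜ y) = A.dimqComponent j x • y := by
  simp [contract]

theorem contract_inclTensor_of_ne {j k l : ℕ} (h : k ≠ j)
    (z : G0 (A.alg k) ⊗[ℤ] G0 (A.alg l)) : A.contract j (A.inclTensor k l z) = 0 := by
  induction z using TensorProduct.induction_on with
  | zero => simp
  | add x y hx hy => rw [map_add, map_add, hx, hy, add_zero]
  | tmul x y => rw [inclTensor_tmul, contract_tmul, A.dimqComponent_incl_of_ne h, zero_smul]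

theorem dimq_contract_inclTensor (j l : ℕ) (z : G0 (A.alg j) ⊗[ℤ] G0 (A.alg l)) :
    A.dimq (A.contract j (A.inclTensor j l z)) = (G0.dim (G0.ext z) : ℤ[X]) := by
  induction z using TensorProduct.induction_on with
  | zero => simp
  | add x y hx hy => simp only [map_add, hx, hy, Int.cast_add]
  | tmul x y => rw [inclTensor_tmul, contract_tmul, dimqComponent_incl_self, map_smul, dimq_incl,
      G0.dim_ext_tmul, smul_eq_mul, Int.cast_mul]

theorem contract_comul_incl {j l n : ℕ} (h : j + l = n) (x : G0 (A.alg n)) :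
    A.contract j (A.comul (A.incl n x)) =
      A.contract j (A.inclTensor j l (A.comulComponent h x)) := by
  rw [comul_incl, map_sum, Finset.sum_eq_single
    ⟨(j, l), Finset.HasAntidiagonal.mem_antidiagonal.2 h⟩]
  · rintro ⟨⟨k, m⟩, hp⟩ - hne
    -- In a fixed total degree the first index determines the second, so every other term is killed
    -- by the contraction.
    refine A.contract_inclTensor_of_ne (fun hk => hne ?_) _
    change k = j at hk
    rw [Finset.HasAntidiagonal.mem_antidiagonal] at hp
    simp only [Subtype.mk.injEq, Prod.mk.injEq]
    omega
  · simp

/-- Linear maps on `G(A)_q` are determined by their values on `G(A)`. -/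
theorem hom_ext {W : Type*} [AddCommGroup W] [Module ℤ[X] W] {n : ℕ}
    {f g : (⨁ n, A.Gq n) →ₗ[ℤ[X]] W}
    (h : ∀ x, f (A.incl n x) = g (A.incl n x)) (z : A.Gq n) :
    f (DirectSum.lof ℤ[X] ℕ A.Gq n z) = g (DirectSum.lof ℤ[X] ℕ A.Gq n z) := by
  obtain ⟨z, rfl⟩ := (A.gqEquiv n).surjective z
  induction z using TensorProduct.induction_on with
  | zero => simp
  | add x y hx hy => simp only [map_add, hx, hy]
  | tmul p x =>
    have : p ⊗ₜ[ℤ] x = p • ((1 : ℤ[X]) ⊗ₜ[ℤ] x) := by simp [TensorProduct.smul_tmul']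
    simp only [this, map_smul]
    exact congrArg _ (h x)

/-- Contracting and then taking the dimension computes the full dimension of the restriction to `Aⱼ
⊗ Aₗ`, which is that of the original module. -/
theorem dimq_contract_comul_lof {j l n : ℕ} (h : j + l = n) (z : A.Gq n) :
    A.dimq (A.contract j (A.comul (DirectSum.lof ℤ[X] ℕ A.Gq n z))) =
      A.dimq (DirectSum.lof ℤ[X] ℕ A.Gq n z) :=
  A.hom_ext (f := A.dimq ∘ₗ A.contract j ∘ₗ A.comul) (g := A.dimq) (fun x => by
    simp only [LinearMap.comp_apply]
    rw [A.contract_comul_incl h, dimq_contract_inclTensor, ext_comulComponent, G0.dim_res,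
      dimq_incl]) z

/-- The dimension in degree zero is a left counit: only the component `triv ⊗ y` survives, and
`triv` has dimension one. -/
theorem contract_zero_comul (y : ⨁ n, A.Gq n) : A.contract 0 (A.comul y) = y := by
  suffices h : A.contract 0 ∘ₗ A.comul = LinearMap.id from LinearMap.congr_fun h y
  refine DirectSum.linearMap_ext ℤ[X] fun n => LinearMap.ext fun z => ?_
  refine A.hom_ext (f := A.contract 0 ∘ₗ A.comul) (g := LinearMap.id) (fun x => ?_) z
  simp only [LinearMap.comp_apply, LinearMap.id_apply]
  rw [A.contract_comul_incl (zero_add n), comulComponent_left, inclTensor_tmul, contract_tmul,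
    dimqComponent_incl_self, dim_triv, Int.cast_one, one_smul]

theorem contract_one_comul_incl_zero (x : G0 (A.alg 0)) :
    A.contract 1 (A.comul (A.incl 0 x)) = 0 := by
  rw [comul_incl, map_sum]
  refine Finset.sum_eq_zero fun p _ => A.contract_inclTensor_of_ne ?_ _
  have := Finset.HasAntidiagonal.mem_antidiagonal.1 p.2
  omega

/-! ### The `q`-Leibniz rule and powers of degree-one elements. -/

section Hopf

variable {A} {mul : (⨁ n, A.Gq n) →ₗ[ℤ[X]] (⨁ n, A.Gq n) →ₗ[ℤ[X]] (⨁ n, A.Gq n)}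
  (H : IsTwistedHopf (Polynomial.X : ℤ[X]) mul A.one A.comul)
include H

/-- With `z` the coproduct of `y`, this is the `q`-Leibniz rule. For `z = a ⊗ b`, the summand `x ⊗
1` contributes only when `a` has degree `0`, and `1 ⊗ x` only when `a` has degree `1`, where moving
`x` past `a` costs one factor `q`. -/
theorem contract_one_twistedMul (x : G0 (A.alg 1))
    (z : (⨁ n, A.Gq n) ⊗[ℤ[X]] (⨁ n, A.Gq n)) :
    A.contract 1 (twistedMul (Polynomial.X : ℤ[X]) mul (A.comul (A.incl 1 x)) z) =
      (G0.dim x : ℤ[X]) • A.contract 0 z +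
        (Polynomial.X : ℤ[X]) • mul (A.incl 1 x) (A.contract 1 z) := by
  induction z using TensorProduct.induction_on with
  | zero => simp
  | add y z hy hz => simp only [map_add, hy, hz, smul_add]; abel
  | tmul a b =>
    induction a using DirectSum.induction_on with
    | zero => simp
    | add y z hy hz => simp only [TensorProduct.add_tmul, map_add, hy, hz, smul_add]; abel
    | of i a =>
      rw [← DirectSum.lof_eq_of ℤ[X], comul_incl_one, map_add, LinearMap.add_apply, map_add]
      have h0 : twistedMul (Polynomial.X : ℤ[X]) mul (A.incl 1 x ⊗ₜ A.incl 0 A.triv)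
          (DirectSum.lof ℤ[X] ℕ A.Gq i a ⊗ₜ b) =
          mul (A.incl 1 x) (DirectSum.lof ℤ[X] ℕ A.Gq i a) ⊗ₜ b := by
        rw [incl_triv, twistedMul_lof, H.one_mul, zero_mul, pow_zero, one_smul]
      have h1 : twistedMul (Polynomial.X : ℤ[X]) mul (A.incl 0 A.triv ⊗ₜ A.incl 1 x)
          (DirectSum.lof ℤ[X] ℕ A.Gq i a ⊗ₜ b) =
          (Polynomial.X : ℤ[X]) ^ i •
            (DirectSum.lof ℤ[X] ℕ A.Gq i a ⊗ₜ mul (A.incl 1 x) b) := by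
        refine (twistedMul_lof _ mul 1 i _ b _ a).trans ?_
        rw [incl_triv, H.one_mul, one_mul]
        rfl
      rw [h0, h1, add_comm]
      simp only [map_smul, contract_tmul]
      congr 1
      · rw [smul_smul]
        congr 1
        -- By connectedness a degree-zero `a` is a scalar multiple of the unit, so `x * a` has
        -- dimension `dim x * dim a`. Otherwise `x * a` has degree `1 + i ≠ 1` and both sides
        -- vanish.
        by_cases hi : i = 0
        · subst hi
          obtain ⟨c, rfl⟩ := H.connected.2 a
          simp only [map_smul, H.mul_one]
          rw [dimqComponent_incl_self, ← incl_triv, dimqComponent_incl_self, dim_triv]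
          simp [mul_comm]
        · obtain ⟨y, hy⟩ := H.mul_mem 1 i (A.gqEquiv 1 (1 ⊗ₜ x)) a
          rw [A.dimqComponent_lof_of_ne hi, mul_zero]
          change A.dimqComponent 1 (mul (DirectSum.lof ℤ[X] ℕ A.Gq 1 (A.gqEquiv 1 (1 ⊗ₜ x))) _) = 0
          rw [← hy, A.dimqComponent_lof_of_ne (by omega)]
      · by_cases hi : i = 1
        · subst hi; rw [pow_one]
        · rw [A.dimqComponent_lof_of_ne hi]; simp

theorem contract_one_comul_starPow (x : G0 (A.alg 1)) (n : ℕ) :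
    A.contract 1 (A.comul (A.starPow mul (A.incl 1 x) (n + 1))) =
      ((G0.dim x : ℤ[X]) * qNat (n + 1)) • A.starPow mul (A.incl 1 x) n := by
  rw [starPow, H.comul_mul, contract_one_twistedMul H, contract_zero_comul]
  -- The induction runs on the Leibniz expansion. The unit has zero derivative, leaving `dim x *
  -- [1]` in the base case.
  induction n with
  | zero =>
    rw [starPow, ← incl_triv, contract_one_comul_incl_zero]
    simp [qNat]
  | succ n ih =>
    -- The induction hypothesis concerns the expanded form, so the derivative of the inner power is
    -- expanded before using it.
    have h : A.contract 1 (A.comul (A.starPow mul (A.incl 1 x) (n + 1))) =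
        ((G0.dim x : ℤ[X]) * qNat (n + 1)) • A.starPow mul (A.incl 1 x) n := by
      conv_lhs => rw [starPow]
      rw [H.comul_mul, contract_one_twistedMul H, contract_zero_comul, ih]
    rw [h, map_smul, smul_smul, ← starPow, ← add_smul, qNat_succ (n + 1)]
    ring_nf

theorem starPow_mem (x : G0 (A.alg 1)) (n : ℕ) : A.starPow mul (A.incl 1 x) n ∈
    LinearMap.range (DirectSum.lof ℤ[X] ℕ A.Gq n) := by
  induction n with
  | zero => exact ⟨_, rfl⟩
  | succ n ih =>
    obtain ⟨z, hz⟩ := ih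
    rw [starPow, ← hz, add_comm]
    exact H.mul_mem 1 n _ z

/-- The `q`-dimension of a power of a primitive element. -/
theorem dimq_starPow (x : G0 (A.alg 1)) (n : ℕ) :
    A.dimq (A.starPow mul (A.incl 1 x) n) = (G0.dim x : ℤ[X]) ^ n * qFactorial n := by
  induction n with
  | zero => simp [starPow, ← incl_triv, dimq_incl, dim_triv, qFactorial]
  | succ n ih =>
    obtain ⟨z, hz⟩ := starPow_mem H x (n + 1)
    -- Homogeneity of degree `1 + n` allows replacing the power by its derivative without changing
    -- the dimension.
    rw [← hz, ← A.dimq_contract_comul_lof (add_comm 1 n), hz, contract_one_comul_starPow H,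
      map_smul, ih, qFactorial, qFactorial, Finset.prod_range_succ, smul_eq_mul]
    ring

end Hopf

end Tower

/-! ### From graded characters to graded dimensions. -/

theorem FilteredTower.dimq_gradedChar (A : FilteredTower.{u}) (n : ℕ) :
    A.dimq (A.gradedChar n) = A.gradedDim n := by
  obtain ⟨N, hN⟩ := A.eventually_subsingleton_gr n
  rw [gradedChar, gradedDim, ← LinearMap.toAddMonoidHom_coe, AddMonoidHom.map_finsum]
  · simp [Tower.dimq_incl, G0.dim_mk]
  -- An additive map commutes with `∑ᶠ` once the support is finite; here the subquotients vanish
  -- from index `N` on.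
  · refine (Set.finite_lt_nat N).subset fun i hi => ?_
    by_contra hlt
    have := hN i (not_lt.1 hlt)
    exact hi (by simp [G0.mk_subsingleton])

end FilteredTowers

theorem theoremT (A : FilteredTowers.FilteredTower.{u}) (L : FilteredTowers.SimpleList (A.alg 1))
    (mul : (⨁ n, A.Gq n) →ₗ[ℤ[X]] (⨁ n, A.Gq n) →ₗ[ℤ[X]] (⨁ n, A.Gq n))
    (quantizes : A.Quantizes mul)
    (Q1 : ∀ x y z, mul (mul x y) z = mul x (mul y z))
    (Q2 : FilteredTowers.IsTwistedHopf (Polynomial.X : ℤ[X]) mul A.one A.comul)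
    (Q3 : ∀ n, A.starPow mul (A.incl 1 L.beta) n = A.gradedChar n) (n : ℕ) :
    A.gradedDim n = (Module.finrank ℂ (A.alg 1) : ℤ[X]) ^ n * FilteredTowers.qFactorial n := by
  rw [← A.dimq_gradedChar, ← Q3, FilteredTowers.Tower.dimq_starPow Q2, L.dim_beta, Int.cast_natCast]
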